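/- Let $T$ be a simplicial tree, identified with its geometric realisation (edges of length one, path metric $d$), and let $v_0$ be a vertex of $T$. Let $<$ be a lexicographic well-ordering of the set of paths without backtracking starting at $v_0$: shorter paths come first, and if two paths of equal length have initial subpaths $p', q'$ of the same smaller length with $p'<q'$, then the path extending $p'$ precedes the path extending $q'$. It is extended to segments $[v_0,w]$ with $w\in T$ not a vertex by comparing first lengths and then, for equal lengths, the edge paths obtained by completing the last edges. For $g\in\operatorname{Aut}(T)$ let $l(g)=\min_{w\in T} d(w,gw)$ and $\gamma(g)=\{w\in T: d(w,gw)=l(g)\}$; $g$ is elliptic if $l(g)=0$ and hyperbolic if $l(g)>0$. A subgroup of $\operatorname{Aut}(T)$ is purely hyperbolic if all its non-trivial elements are hyperbolic. For hyperbolic $g$, $\gamma(g)$ is a line; let $\operatorname{proj}_{\gamma(g)}$ be the nearest-point projection onto it, and let $U^0_g=(u^-_g,u^+_g]$ be the half-open interval of $\gamma(g)$ of radius $l(g)/2$ centred at $\operatorname{proj}_{\gamma(g)}(v_0)$, its ends being labelled so that $[v_0,u^+_g]<[v_0,u^-_g]$. Let $U^-_g$ and $U^+_g$ be the two components of $\gamma(g)\setminus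 U^0_g$, with $u^-_g\in U^-_g$. If a finite set $X\subseteq\operatorname{Aut}(T)$ contains no elliptic elements and $\operatorname{proj}_{\gamma(g)}(\gamma(h))\subseteq U^0_g$ for all distinct $g,h\in X$, then $U=\bigcup_{g\in X}\{U^-_g,U^0_g,U^+_g\}$ is called the fundamental system of $X$. A set $U$ is a fundamental system of a subgroup $G$ if it is the fundamental system of some finite set $X$ generating $G$. **Corollary.** With $T$, $v_0$ and $<$ fixed, every finitely generated purely hyperbolic subgroup $G$ of $\operatorname{Aut}(T)$ admits a unique fundamental system. -/

import Mathlib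

namespace TreeAut

noncomputable section

variable {V : Type*}

/-- The geometric realisation of a graph, in barycentric coordinates: a point is a convex combination
of the two ends of an edge, or a single vertex (the case `a = b`). -/
def Point (T : SimpleGraph V) : Type _ :=
  {c : V →₀ ℝ // ∃ (a b : V) (t : ℝ), (a = b ∨ T.Adj a b) ∧ 0 ≤ t ∧ t ≤ 1 ∧
    c = Finsupp.single a (1 - t) + Finsupp.single b t}

/-- A vertex, regarded as a point of the geometric realisation. -/
def vertex (T : SimpleGraph V) (v : V) : Point T :=
  ⟨Finsupp.single v 1, v, v, 0, Or.inl rfl, le_refl _, zero_le_one, by simp⟩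

/-- The action of an automorphism on the geometric realisation, affine on every edge. -/
def act {T : SimpleGraph V} (g : T ≃g T) (p : Point T) : Point T :=
  ⟨Finsupp.mapDomain g p.1, by
    obtain ⟨c, a, b, t, hab, h0, h1, rfl⟩ := p
    refine ⟨g a, g b, t, ?_, h0, h1, ?_⟩
    · rcases hab with rfl | h
      · exact Or.inl rfl
      · exact Or.inr (g.map_rel_iff.2 h)
    · rw [Finsupp.mapDomain_add, Finsupp.mapDomain_single, Finsupp.mapDomain_single]⟩

/-- The path metric on the geometric realisation in which every edge has length one. It is the
length of the shortest route from `p` to `q`: either straight along a common edge `ab`, or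
from `p` to an end `x` of its edge, then along edges to an end `y` of the edge of `q`, then to `q`. -/
def pdist {T : SimpleGraph V} (p q : Point T) : ℝ :=
  sInf ({r : ℝ | ∃ a b : V, (a = b ∨ T.Adj a b) ∧ (p.1.support : Set V) ⊆ {a, b} ∧
          (q.1.support : Set V) ⊆ {a, b} ∧ r = |p.1 a - q.1 a|} ∪
        {r : ℝ | ∃ x ∈ p.1.support, ∃ y ∈ q.1.support,
          r = (1 - p.1 x) + (T.dist x y : ℝ) + (1 - q.1 y)})

/-- The segment `[p, q]`. -/
def segment {T : SimpleGraph V} (p q : Point T) : Set (Point T) :=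
  {w | pdist p w + pdist w q = pdist p q}

/-- The component of `S` containing `p`. In a tree any connected set containing `p` and `w`
contains the segment `[p, w]`. -/
def component {T : SimpleGraph V} (S : Set (Point T)) (p : Point T) : Set (Point T) :=
  {w | segment p w ⊆ S}

open Classical in
/-- The nearest-point projection to `C` (a junk value is taken when `C` has no nearest point). -/
def proj {T : SimpleGraph V} (C : Set (Point T)) (w : Point T) : Point T :=
  if h : ∃ a ∈ C, ∀ b ∈ C, pdist w a ≤ pdist w b then h.choose else w

/-- The translation length `l(g)`, the minimum of `d(w, gw)` over all points `w`. -/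
def translationLength {T : SimpleGraph V} (g : T ≃g T) : ℝ :=
  ⨅ w : Point T, pdist w (act g w)

/-- The minimum translation set of `g`; for hyperbolic `g` this is the translation axis. -/
def minSet {T : SimpleGraph V} (g : T ≃g T) : Set (Point T) :=
  {w | pdist w (act g w) = translationLength g}

def IsElliptic {T : SimpleGraph V} (g : T ≃g T) : Prop := translationLength g = 0

def IsHyperbolic {T : SimpleGraph V} (g : T ≃g T) : Prop := 0 < translationLength g

def IsPurelyHyperbolic {T : SimpleGraph V} (G : Subgroup (T ≃g T)) : Prop :=
  ∀ g ∈ G, g ≠ 1 → IsHyperbolic g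

/-- The set `P` of paths (without backtracking) with initial vertex `v₀`. -/
abbrev PathFrom (T : SimpleGraph V) (v₀ : V) : Type _ := Σ v : V, T.Path v₀ v

/-- The length of a path. -/
def PathFrom.length {T : SimpleGraph V} {v₀ : V} (p : PathFrom T v₀) : ℕ :=
  (p.2 : T.Walk v₀ p.1).length

/-- The initial subpath of length `j` (the whole path when `j` is at least its length). -/
def PathFrom.initial {T : SimpleGraph V} {v₀ : V} (p : PathFrom T v₀) (j : ℕ) : PathFrom T v₀ :=
  ⟨(p.2 : T.Walk v₀ p.1).getVert j, (p.2 : T.Walk v₀ p.1).take j, p.2.2.take j⟩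

/-- A lexicographic well-ordering of the paths from `v₀`: shorter paths come first, and two paths
of the same length are compared as any shorter initial subpaths that are already ordered. -/
structure LexPathOrder (T : SimpleGraph V) (v₀ : V) where
  lt : PathFrom T v₀ → PathFrom T v₀ → Prop
  isWellOrder : IsWellOrder (PathFrom T v₀) lt
  lt_of_length_lt : ∀ p q : PathFrom T v₀, p.length < q.length → lt p q
  lt_of_initial_lt : ∀ p q : PathFrom T v₀, p.length = q.length →
    ∀ j < p.length, lt (p.initial j) (q.initial j) → lt p q

/-- `P` is the shortest path along edges from `v₀` which contains the segment `[v₀, w]`: it contains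
the edge (or vertex) carrying `w` and ends there. If `w` is a vertex, then `P` is `[v₀, w]`. -/
def Covers {T : SimpleGraph V} {v₀ : V} (P : PathFrom T v₀) (w : Point T) : Prop :=
  P.1 ∈ w.1.support ∧ ∀ v ∈ w.1.support, v ∈ (P.2 : T.Walk v₀ P.1).support

/-- The comparison `[v₀, p] < [v₀, q]` for points `p`, `q`: first by length, then
lexicographically. On vertices it is the given ordering. For points inside edges at the same
distance from `v₀`, the segments are ordered as the edge paths completing their last edges. -/
def LexPathOrder.pointLT {T : SimpleGraph V} {v₀ : V} (O : LexPathOrder T v₀) (p q : Point T) :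
    Prop :=
  pdist (vertex T v₀) p < pdist (vertex T v₀) q ∨
    (pdist (vertex T v₀) p = pdist (vertex T v₀) q ∧
      ∃ P Q : PathFrom T v₀, Covers P p ∧ Covers Q q ∧ O.lt P Q)

/-- The centre of the interval `U⁰`: the projection of `v₀` to the axis of `g`. -/
def center {T : SimpleGraph V} (v₀ : V) (g : T ≃g T) : Point T :=
  proj (minSet g) (vertex T v₀)

/-- `(u⁻, u⁺)` are the two points of the axis of `g` at distance `l(g)/2` from the centre,
labelled so that `[v₀, u⁺] < [v₀, u⁻]`. -/
def IsEnds {T : SimpleGraph V} {v₀ : V} (O : LexPathOrder T v₀) (g : T ≃g T)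
    (u : Point T × Point T) : Prop :=
  u.1 ∈ minSet g ∧ u.2 ∈ minSet g ∧
    pdist (center v₀ g) u.1 = translationLength g / 2 ∧
    pdist (center v₀ g) u.2 = translationLength g / 2 ∧ O.pointLT u.2 u.1

open Classical in
/-- The pair `(u⁻, u⁺)` of a hyperbolic `g` (a junk value if there is none). -/
def ends {T : SimpleGraph V} {v₀ : V} (O : LexPathOrder T v₀) (g : T ≃g T) :
    Point T × Point T :=
  if h : ∃ u, IsEnds O g u then h.choose else (vertex T v₀, vertex T v₀)

/-- `u⁻` -/
def uMinus {T : SimpleGraph V} {v₀ : V} (O : LexPathOrder T v₀) (g : T ≃g T) : Point T :=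
  (ends O g).1

/-- `u⁺` -/
def uPlus {T : SimpleGraph V} {v₀ : V} (O : LexPathOrder T v₀) (g : T ≃g T) : Point T :=
  (ends O g).2

/-- The half-open interval `U⁰ = (u⁻, u⁺]` of the axis of `g`. -/
def UZero {T : SimpleGraph V} {v₀ : V} (O : LexPathOrder T v₀) (g : T ≃g T) : Set (Point T) :=
  segment (uMinus O g) (uPlus O g) \ {uMinus O g}

/-- The component of the complement of `U⁰` in the axis which contains `u⁻`. -/
def UMinus {T : SimpleGraph V} {v₀ : V} (O : LexPathOrder T v₀) (g : T ≃g T) : Set (Point T) :=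
  component (minSet g \ UZero O g) (uMinus O g)

/-- The other component of the complement of `U⁰` in the axis. -/
def UPlus {T : SimpleGraph V} {v₀ : V} (O : LexPathOrder T v₀) (g : T ≃g T) : Set (Point T) :=
  (minSet g \ UZero O g) \ UMinus O g

/-- `X` has a fundamental system, and it is `U`. -/
def IsFundamentalSystemOfSet {T : SimpleGraph V} {v₀ : V} (O : LexPathOrder T v₀)
    (X : Set (T ≃g T)) (U : Set (Set (Point T))) : Prop :=
  (∀ g ∈ X, ¬ IsElliptic g) ∧
  (∀ g ∈ X, ∀ h ∈ X \ {g}, proj (minSet g) '' minSet h ⊆ UZero O g) ∧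
  U = ⋃ g ∈ X, {UMinus O g, UZero O g, UPlus O g}

/-- `U` is a fundamental system of the group `G`: it is the fundamental system of some finite
generating set of `G`. -/
def IsFundamentalSystem {T : SimpleGraph V} {v₀ : V} (O : LexPathOrder T v₀)
    (G : Subgroup (T ≃g T)) (U : Set (Set (Point T))) : Prop :=
  ∃ X : Set (T ≃g T), X.Finite ∧ Subgroup.closure X = G ∧ IsFundamentalSystemOfSet O X U

end

end TreeAut

namespace TreeAut

open SimpleGraph

section

variable {V : Type*} {T : SimpleGraph V}

/-! ### Distances in trees -/

theorem dist_apply (g : T ≃g T) (x y : V) : T.dist (g x) (g y) = T.dist x y := by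
  have key : ∀ (g : T ≃g T) (x y : V), T.Reachable x y → T.dist (g x) (g y) ≤ T.dist x y := by
    intro g x y h
    obtain ⟨p, hp⟩ := h.exists_walk_length_eq_dist
    rw [← hp, ← Walk.length_map g.toHom p]
    exact SimpleGraph.dist_le (p.map g.toHom)
  by_cases h : T.Reachable x y
  · refine le_antisymm (key g x y h) ?_
    have h' : T.Reachable (g x) (g y) := h.map g.toHom
    simpa using key g.symm (g x) (g y) h'
  · have h' : ¬ T.Reachable (g x) (g y) := fun H => h (by
      simpa using H.map g.symm.toHom)
    rw [dist_eq_zero_of_not_reachable h, dist_eq_zero_of_not_reachable h']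

theorem adj_apply (g : T ≃g T) {x y : V} : T.Adj (g x) (g y) ↔ T.Adj x y := g.map_rel_iff

theorem abs_dist_sub_of_adj (hT : T.IsTree) (u : V) {v w : V} (h : T.Adj v w) :
    (T.dist u v : ℤ) = T.dist u w + 1 ∨ (T.dist u w : ℤ) = T.dist u v + 1 := by
  rcases hT.dist_eq_dist_add_one_of_adj u h with h | h <;> omega

theorem eq_of_adj_of_dist_lt (hT : T.IsTree) {r u x y : V} (hx : T.Adj u x) (hy : T.Adj u y)
    (hdx : T.dist r x < T.dist r u) (hdy : T.dist r y < T.dist r u) : x = y := by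
  have key : ∀ z, T.Adj u z → T.dist r z < T.dist r u →
      ∃ p : T.Walk r u, p.IsPath ∧ p.penultimate = z := by
    intro z hz hd
    obtain ⟨p, hp⟩ := hT.connected.exists_walk_length_eq_dist r z
    have hlen : (p.concat hz.symm).length = T.dist r u := by
      rw [Walk.length_concat, hp]
      rcases hT.dist_eq_dist_add_one_of_adj r hz with h | h <;> omega
    exact ⟨p.concat hz.symm, Walk.isPath_of_length_eq_dist _ hlen, by simp⟩
  obtain ⟨p, hp, rfl⟩ := key x hx hdx
  obtain ⟨q, hq, rfl⟩ := key y hy hdy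
  rw [(hT.existsUnique_path r u).unique hp hq]

theorem exists_adj_dist_eq (hT : T.IsTree) {r v : V} (h : v ≠ r) :
    ∃ x, T.Adj v x ∧ T.dist r v = T.dist r x + 1 := by
  obtain ⟨p, hp⟩ := hT.connected.exists_walk_length_eq_dist v r
  cases p with
  | nil => exact absurd rfl h
  | @cons _ x _ hx q =>
    refine ⟨x, hx, ?_⟩
    rw [Walk.length_cons, SimpleGraph.dist_comm] at hp
    have := SimpleGraph.dist_le q
    rw [SimpleGraph.dist_comm] at this
    have := abs_dist_sub_of_adj hT r hx
    omega

/-- A bi-infinite path without backtracking. -/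
structure IsLine (T : SimpleGraph V) (L : ℤ → V) : Prop where
  adj : ∀ i, T.Adj (L i) (L (i + 1))
  ne : ∀ i, L i ≠ L (i + 2)

/-- The index of a vertex of the line nearest to a given vertex. -/
noncomputable def foot (T : SimpleGraph V) (L : ℤ → V) (v : V) : ℤ :=
  Function.argmin (fun i => T.dist v (L i))

/-- The distance of a vertex from a line. -/
noncomputable def height (T : SimpleGraph V) (L : ℤ → V) (v : V) : ℤ :=
  T.dist v (L (foot T L v))

variable {L : ℤ → V}

theorem height_nonneg (v : V) : 0 ≤ height T L v := by
  unfold height; positivity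

theorem IsLine.affine (hL : IsLine T L) (ε c : ℤ) (hε : ε = 1 ∨ ε = -1) :
    IsLine T (fun i => L (c + ε * i)) := by
  rcases hε with rfl | rfl
  · constructor
    · intro i; convert hL.adj (c + i) using 2 <;> ring
    · intro i
      have := hL.ne (c + i)
      rw [add_assoc] at this
      simpa only [one_mul] using this
  · constructor
    · intro i; convert (hL.adj (c - (i + 1))).symm using 2 <;> ring
    · intro i
      have := (hL.ne (c - (i + 2))).symm
      rwa [show c - (i + 2) + 2 = c + -1 * i by ring,
        show c - (i + 2) = c + -1 * (i + 2) by ring] at this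

theorem IsLine.dist_eq_of_le (hT : T.IsTree) (hL : IsLine T L) (v : V) (i : ℤ)
    (hi : T.dist v (L i) < T.dist v (L (i + 1))) (n : ℕ) :
    (T.dist v (L (i + n)) : ℤ) = T.dist v (L i) + n := by
  have key : ∀ n : ℕ, (T.dist v (L (i + n)) : ℤ) = T.dist v (L i) + n ∧
      T.dist v (L (i + n)) < T.dist v (L (i + n + 1)) := by
    intro n
    induction n with
    | zero => simpa using hi
    | succ n ih =>
      have h1 := abs_dist_sub_of_adj hT v (hL.adj (i + n))
      have e : i + ((n + 1 : ℕ) : ℤ) = i + n + 1 := by push_cast; ring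
      rw [e]
      refine ⟨by push_cast; omega, ?_⟩
      have h2 := abs_dist_sub_of_adj hT v (hL.adj (i + n + 1))
      by_contra hc
      have := eq_of_adj_of_dist_lt hT (hL.adj (i + n)).symm (hL.adj (i + n + 1)) ih.2 (by omega)
      refine hL.ne (i + n) (this.trans ?_)
      congr 1; ring
  exact (key n).1

theorem IsLine.dist_eq (hT : T.IsTree) (hL : IsLine T L) (v : V) (j : ℤ) :
    (T.dist v (L j) : ℤ) = height T L v + |j - foot T L v| := by
  have hmin : ∀ j, T.dist v (L (foot T L v)) ≤ T.dist v (L j) := fun j =>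
    Function.argmin_le (fun i => T.dist v (L i)) j
  unfold height
  generalize foot T L v = i at hmin ⊢
  rcases le_total i j with h | h
  · obtain ⟨n, rfl⟩ := Int.le.dest h
    rw [hL.dist_eq_of_le hT v i _ n]
    · simp
    · have := abs_dist_sub_of_adj hT v (hL.adj i)
      have := hmin (i + 1)
      omega
  · obtain ⟨n, rfl⟩ := Int.le.dest h
    have := (hL.affine (-1) (j + n) (Or.inr rfl)).dist_eq_of_le hT v 0 ?_ n
    · simp only [mul_zero, add_zero, zero_add] at this
      rw [show j - (j + n : ℤ) = -n by ring, abs_neg, Nat.abs_cast, ← this]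
      congr 3; ring
    · have h1 := abs_dist_sub_of_adj hT v (hL.adj (j + n - 1))
      have h2 := hmin (j + n - 1)
      have e : (j + n - 1 : ℤ) + 1 = j + n := by ring
      have e' : (j + n : ℤ) + -1 * (0 + 1) = j + n - 1 := by ring
      rw [e] at h1
      simp only [mul_zero, add_zero, e']
      omega

theorem IsLine.foot_height_of_dist (hT : T.IsTree) (hL : IsLine T L) (v : V) (h p : ℤ)
    (H : ∀ j, (T.dist v (L j) : ℤ) = h + |j - p|) : foot T L v = p ∧ height T L v = h := by
  have h1 := H p
  have h2 := H (foot T L v)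
  rw [hL.dist_eq hT] at h1 h2
  simp only [sub_self, abs_zero, add_zero] at h1 h2
  have e := abs_sub_comm p (foot T L v)
  have h3 : |foot T L v - p| = 0 := by linarith [abs_nonneg (foot T L v - p)]
  have h4 := abs_eq_zero.1 h3
  exact ⟨by linarith, by linarith⟩

theorem IsLine.dist_line (hT : T.IsTree) (hL : IsLine T L) (i j : ℤ) :
    (T.dist (L i) (L j) : ℤ) = |j - i| := by
  have h := hL.dist_eq hT (L i) i
  rw [SimpleGraph.dist_self] at h
  have h1 := height_nonneg (T := T) (L := L) (L i)
  have h2 := abs_nonneg (i - foot T L (L i))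
  have h3 : |i - foot T L (L i)| = 0 := by push_cast at h; omega
  have h4 : foot T L (L i) = i := by have := abs_eq_zero.1 h3; omega
  rw [hL.dist_eq hT, h4]
  push_cast at h; omega

theorem IsLine.foot_line (hT : T.IsTree) (hL : IsLine T L) (i : ℤ) : foot T L (L i) = i :=
  (hL.foot_height_of_dist hT (L i) 0 i fun j => by rw [hL.dist_line hT]; ring).1

theorem IsLine.height_line (hT : T.IsTree) (hL : IsLine T L) (i : ℤ) : height T L (L i) = 0 :=
  (hL.foot_height_of_dist hT (L i) 0 i fun j => by rw [hL.dist_line hT]; ring).2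

theorem IsLine.injective (hT : T.IsTree) (hL : IsLine T L) : Function.Injective L := by
  intro i j h
  rw [← hL.foot_line hT i, h, hL.foot_line hT]

theorem eq_line_foot_of_height_eq_zero (hT : T.IsTree) {v : V} (h : height T L v = 0) :
    v = L (foot T L v) := by
  unfold height at h
  exact hT.connected.dist_eq_zero_iff.1 (by exact_mod_cast h)

/-- Both ends of an edge lie on the line and are consecutive, or they have the same foot and their
heights differ by one. -/
theorem IsLine.adj_cases (hT : T.IsTree) (hL : IsLine T L) {v w : V} (h : T.Adj v w) :
    (height T L v = 0 ∧ height T L w = 0 ∧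
      (foot T L w = foot T L v + 1 ∨ foot T L v = foot T L w + 1)) ∨
    (foot T L v = foot T L w ∧
      (height T L w = height T L v + 1 ∨ height T L v = height T L w + 1)) := by
  wlog hle : foot T L v ≤ foot T L w generalizing v w
  · rcases this h.symm (by omega) with h | h
    · left; omega
    · right; omega
  have key : ∀ j, height T L v + |j - foot T L v| = height T L w + |j - foot T L w| + 1 ∨
      height T L w + |j - foot T L w| = height T L v + |j - foot T L v| + 1 := by
    intro j
    have := abs_dist_sub_of_adj hT (L j) h
    rwa [SimpleGraph.dist_comm, hL.dist_eq hT, SimpleGraph.dist_comm, hL.dist_eq hT] at this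
  have k1 := key (foot T L v)
  have k2 := key (foot T L w)
  simp only [sub_self, abs_zero, add_zero] at k1 k2
  rw [abs_of_nonpos (by omega)] at k1
  rw [abs_of_nonneg (by omega)] at k2
  rcases hle.eq_or_lt with heq | hlt
  · right; omega
  have hf : foot T L w = foot T L v + 1 := by omega
  have hh : height T L v = height T L w := by omega
  left
  refine ⟨?_, ?_, Or.inl hf⟩ <;> by_contra h0
  all_goals
    have hpos : 0 < height T L v := by
      have := height_nonneg (T := T) (L := L) v
      omega
    have d1 := hL.dist_eq hT v (foot T L v)
    have d2 := hL.dist_eq hT w (foot T L v)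
    have d3 := hL.dist_eq hT v (foot T L v + 1)
    have d4 := hL.dist_eq hT w (foot T L v + 1)
    have ne : v ≠ L (foot T L v) := fun e => by
      rw [← e, SimpleGraph.dist_self] at d1; simp at d1; omega
    obtain ⟨x, hx, e1⟩ := exists_adj_dist_eq hT ne
    rw [SimpleGraph.dist_comm, SimpleGraph.dist_comm (v := x)] at e1
    have e2 := abs_dist_sub_of_adj hT x (hL.adj (foot T L v))
    simp only [hf, hh, sub_self, abs_zero, add_zero, add_sub_cancel_left, abs_one,
      sub_add_cancel_left, abs_neg] at d1 d2 d3 d4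
    have : x = w := by
      refine eq_of_adj_of_dist_lt hT (r := L (foot T L v + 1)) hx h ?_ ?_
      · rw [SimpleGraph.dist_comm, SimpleGraph.dist_comm (u := L (foot T L v + 1))]; omega
      · rw [SimpleGraph.dist_comm, SimpleGraph.dist_comm (u := L (foot T L v + 1))]; omega
    subst this
    omega

theorem IsLine.abs_height_sub_le (hT : T.IsTree) (hL : IsLine T L) (v w : V) :
    |height T L v - height T L w| ≤ T.dist v w := by
  obtain ⟨p, hp⟩ := hT.connected.exists_walk_length_eq_dist v w
  rw [← hp]
  clear hp
  induction p with
  | nil => simp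
  | cons h q ih =>
    rw [abs_le] at ih ⊢
    rw [Walk.length_cons]
    push_cast
    rcases hL.adj_cases hT h with h | h <;> omega

theorem IsLine.le_dist (hT : T.IsTree) (hL : IsLine T L) {v w : V} (hne : foot T L v ≠ foot T L w) :
    height T L v + |foot T L v - foot T L w| + height T L w ≤ T.dist v w := by
  obtain ⟨p, hp⟩ := hT.connected.exists_walk_length_eq_dist v w
  rw [← hp]
  clear hp
  induction p with
  | nil => exact absurd rfl hne
  | @cons a b c h q ih =>
    have l1 := hL.abs_height_sub_le hT b c
    have l2 : T.dist b c ≤ q.length := SimpleGraph.dist_le q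
    rw [Walk.length_cons]
    push_cast
    rw [abs_le] at l1
    by_cases hbc : foot T L b = foot T L c
    · rcases hL.adj_cases hT h with h | h
      · rw [← hbc]
        rcases h with ⟨h1, h2, h3 | h3⟩ <;> simp [h3] <;> omega
      · exact absurd (h.1.trans hbc) hne
    · have := ih hbc
      rcases hL.adj_cases hT h with h | h
      · have := abs_sub_le (foot T L a) (foot T L b) (foot T L c)
        have : |foot T L a - foot T L b| = 1 := by
          rcases h with ⟨h1, h2, h3 | h3⟩ <;> simp [h3]
        omega
      · rw [h.1]; omega

theorem IsLine.dist_eq_of_ne (hT : T.IsTree) (hL : IsLine T L) {v w : V}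
    (hne : foot T L v ≠ foot T L w) :
    (T.dist v w : ℤ) = height T L v + |foot T L v - foot T L w| + height T L w := by
  refine le_antisymm ?_ (hL.le_dist hT hne)
  have h1 := hT.connected.dist_triangle (u := v) (v := L (foot T L w)) (w := w)
  have h2 := hL.dist_eq hT v (foot T L w)
  rw [abs_sub_comm] at h2
  have h3 : (T.dist (L (foot T L w)) w : ℤ) = height T L w := by
    rw [SimpleGraph.dist_comm]; rfl
  omega

theorem IsLine.dist_le (hT : T.IsTree) (hL : IsLine T L) (v w : V) :
    (T.dist v w : ℤ) ≤ height T L v + |foot T L v - foot T L w| + height T L w := by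
  have h1 := hT.connected.dist_triangle (u := v) (v := L (foot T L w)) (w := w)
  have h2 := hL.dist_eq hT v (foot T L w)
  rw [abs_sub_comm] at h2
  have h3 : (T.dist (L (foot T L w)) w : ℤ) = height T L w := by
    rw [SimpleGraph.dist_comm]; rfl
  omega

/-! ### Axes -/

/-- `L` is a line on which `g` acts as the non-trivial translation by `l`. -/
structure IsAxis (g : T ≃g T) (L : ℤ → V) (l : ℤ) : Prop extends IsLine T L where
  map : ∀ i, g (L i) = L (i + l)
  ne_zero : l ≠ 0

theorem IsAxis.inv {g : T ≃g T} {l : ℤ} (hL : IsAxis g L l) : IsAxis g⁻¹ L (-l) where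
  toIsLine := hL.toIsLine
  map i := by
    have := hL.map (i + -l)
    rw [neg_add_cancel_right] at this
    rw [← this]
    exact g.symm_apply_apply _
  ne_zero := neg_ne_zero.2 hL.ne_zero

theorem IsAxis.affine {g : T ≃g T} {l : ℤ} (hL : IsAxis g L l) (ε c : ℤ) (hε : ε = 1 ∨ ε = -1) :
    IsAxis g (fun i => L (c + ε * i)) (ε * l) where
  toIsLine := hL.toIsLine.affine ε c hε
  map i := by
    rw [hL.map]
    congr 1
    rcases hε with rfl | rfl <;> ring
  ne_zero := by rcases hε with rfl | rfl <;> simpa using hL.ne_zero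

theorem IsAxis.foot_height_map {g : T ≃g T} {l : ℤ} (hT : T.IsTree) (hL : IsAxis g L l) (v : V) :
    foot T L (g v) = foot T L v + l ∧ height T L (g v) = height T L v := by
  refine hL.foot_height_of_dist hT _ _ _ fun j => ?_
  have : L j = g (L (j - l)) := by rw [hL.map, sub_add_cancel]
  rw [this, dist_apply, hL.dist_eq hT]
  congr 2; ring

theorem IsAxis.foot_map {g : T ≃g T} {l : ℤ} (hT : T.IsTree) (hL : IsAxis g L l) (v : V) :
    foot T L (g v) = foot T L v + l := (hL.foot_height_map hT v).1

theorem IsAxis.height_map {g : T ≃g T} {l : ℤ} (hT : T.IsTree) (hL : IsAxis g L l) (v : V) :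
    height T L (g v) = height T L v := (hL.foot_height_map hT v).2

theorem foot_affine (hT : T.IsTree) (hL : IsLine T L) (ε c : ℤ) (hε : ε = 1 ∨ ε = -1) (v : V) :
    foot T (fun i => L (c + ε * i)) v = ε * (foot T L v - c) := by
  refine ((hL.affine ε c hε).foot_height_of_dist hT v (height T L v) _ fun j => ?_).1
  rw [hL.dist_eq hT]
  rcases hε with rfl | rfl
  · congr 2; ring
  · rw [← abs_neg]; congr 2; ring

theorem dist_le_of_chain (f : ℕ → V) (n m : ℕ) (hT : T.IsTree)
    (hf : ∀ i, n ≤ i → i < n + m → T.Adj (f i) (f (i + 1))) : T.dist (f n) (f (n + m)) ≤ m := by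
  induction m with
  | zero => simp
  | succ m ih =>
    have h1 := ih fun i h1 h2 => hf i h1 (by omega)
    have h2 := dist_eq_one_iff_adj.2 (hf (n + m) (by omega) (by omega))
    have := hT.connected.dist_triangle (u := f n) (v := f (n + m)) (w := f (n + m + 1))
    rw [← add_assoc]; omega

/-- An automorphism of a tree without fixed vertices and inverted edges has an axis. -/
theorem exists_isAxis (hT : T.IsTree) (g : T ≃g T) (hfix : ∀ v, g v ≠ v)
    (hinv : ∀ v, T.Adj v (g v) → g (g v) ≠ v) : ∃ L l, IsAxis g L l := by
  classical
  have := hT.connected.nonempty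
  set v := Function.argmin (fun v => T.dist v (g v)) with hv
  have hmin : ∀ w, T.dist v (g v) ≤ T.dist w (g w) := fun w =>
    Function.argmin_le (fun v => T.dist v (g v)) w
  obtain ⟨p, hp⟩ := hT.connected.exists_walk_length_eq_dist v (g v)
  have hpath := p.isPath_of_length_eq_dist hp
  have hinj := hpath.getVert_injOn
  set n := p.length with hn
  have hn0 : 0 < n := by
    rw [hp]; exact hT.connected.pos_dist_of_ne (hfix v).symm
  set f : ℕ → V := p.getVert with hfdef
  have f0 : f 0 = v := p.getVert_zero
  have fn : f n = g v := p.getVert_length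
  have fadj : ∀ i < n, T.Adj (f i) (f (i + 1)) := fun i hi => p.adj_getVert_succ hi
  set L : ℤ → V := fun i => (g ^ (i / n)) (f (i % n).toNat) with hL
  have gmul : ∀ (q : ℤ) x, (g ^ (q + 1)) x = (g ^ q) (g x) := fun q x => by
    rw [zpow_add_one]; rfl
  have Lform : ∀ (q : ℤ) (r : ℕ), r ≤ n → L (q * n + r) = (g ^ q) (f r) := by
    intro q r hr
    rcases hr.eq_or_lt with rfl | hr
    · have e : q * n + n = (q + 1) * (n : ℤ) := by ring
      rw [e]
      simp only [hL]
      rw [Int.mul_ediv_cancel _ (by omega), Int.mul_emod_left, fn, ← gmul]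
      simp [f0]
    · simp only [hL]
      have h1 : (q * n + r) / (n : ℤ) = q := by
        rw [add_comm, Int.add_mul_ediv_right _ _ (by omega),
          Int.ediv_eq_zero_of_lt (by omega) (by omega), zero_add]
      have h2 : (q * n + r) % (n : ℤ) = r := by
        rw [add_comm, Int.add_mul_emod_self_right]
        exact Int.emod_eq_of_lt (by omega) (by omega)
      rw [h1, h2, Int.toNat_natCast]
  have decomp : ∀ i : ℤ, ∃ (q : ℤ) (r : ℕ), r < n ∧ i = q * n + r := by
    intro i
    refine ⟨i / n, (i % n).toNat, ?_, ?_⟩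
    · have := Int.emod_lt_of_pos i (b := n) (by omega)
      omega
    · rw [Int.toNat_of_nonneg (Int.emod_nonneg _ (by omega))]
      linarith [Int.emod_add_mul_ediv i n, mul_comm (n : ℤ) (i / n)]
  refine ⟨L, n, ⟨⟨fun i => ?_, fun i => ?_⟩, fun i => ?_, by omega⟩⟩
  · obtain ⟨q, r, hr, rfl⟩ := decomp i
    have := Lform q (r + 1) (by omega)
    push_cast at this
    rw [add_assoc, this, Lform q r hr.le, adj_apply]
    exact fadj r hr
  · obtain ⟨q, r, hr, rfl⟩ := decomp i
    rw [Lform q r hr.le]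
    by_cases hr2 : r + 2 ≤ n
    · have := Lform q (r + 2) hr2
      push_cast at this
      rw [add_assoc, this]
      intro h
      have := hinj (by simp; omega) (by simp; omega) ((g ^ q).injective h)
      omega
    · have e : q * n + r + 2 = (q + 1) * (n : ℤ) + (1 : ℕ) := by
        have : (r : ℤ) = n - 1 := by omega
        rw [this]; push_cast; ring
      rw [e, Lform (q + 1) 1 hn0, gmul]
      intro h
      have h := (g ^ q).injective h
      by_cases h1 : n = 1
      · have hr0 : r = 0 := by omega
        rw [hr0, f0] at h
        rw [h1] at fn
        rw [fn] at h
        refine hinv v ?_ h.symm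
        rw [← fn, ← f0]; exact fadj 0 hn0
      · have d := hmin (f 1)
        rw [← h, ← hp] at d
        have := dist_le_of_chain f 1 (n - 2) hT fun i _ _ => fadj i (by omega)
        rw [show 1 + (n - 2) = r by omega] at this
        omega
  · obtain ⟨q, r, hr, rfl⟩ := decomp i
    rw [Lform q r hr.le]
    have e : q * n + r + n = (q + 1) * (n : ℤ) + r := by ring
    rw [e, Lform _ r hr.le, zpow_add_one, ← (Commute.self_zpow g q).eq]
    rfl

end

section

variable {V : Type*} {T : SimpleGraph V} {L : ℤ → V}

/-! ### Points of the geometric realisation -/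

/-- The affine extension of a function on the vertices to the geometric realisation. -/
noncomputable def Point.avg (φ : V → ℝ) (p : Point T) : ℝ := Finsupp.linearCombination ℝ φ p.1

theorem Point.avg_of_eq {p : Point T} {a b : V} {t : ℝ}
    (h : p.1 = Finsupp.single a (1 - t) + Finsupp.single b t) (φ : V → ℝ) :
    p.avg φ = (1 - t) * φ a + t * φ b := by
  rw [Point.avg, h, map_add, Finsupp.linearCombination_single, Finsupp.linearCombination_single]
  rfl

theorem Point.avg_vertex (v : V) (φ : V → ℝ) : (vertex T v).avg φ = φ v := by
  simp [Point.avg, vertex, Finsupp.linearCombination_single]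

theorem Point.avg_act (g : T ≃g T) (p : Point T) (φ : V → ℝ) :
    (act g p).avg φ = p.avg (fun v => φ (g v)) := by
  simp only [Point.avg, act, Finsupp.linearCombination_mapDomain]
  rfl

theorem Point.nonneg (p : Point T) (v : V) : 0 ≤ p.1 v := by
  classical
  obtain ⟨a, b, t, -, h0, h1, h⟩ := p.2
  rw [h, Finsupp.add_apply, Finsupp.single_apply, Finsupp.single_apply]
  split_ifs <;> linarith

theorem Point.avg_one (p : Point T) : p.avg (fun _ => 1) = 1 := by
  obtain ⟨a, b, t, -, h0, h1, h⟩ := p.2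
  rw [Point.avg_of_eq h]; ring

theorem Point.le_one (p : Point T) (v : V) : p.1 v ≤ 1 := by
  classical
  obtain ⟨a, b, t, -, h0, h1, h⟩ := p.2
  rw [h, Finsupp.add_apply, Finsupp.single_apply, Finsupp.single_apply]
  split_ifs <;> linarith

theorem Point.avg_of_support {p : Point T} {a b : V} (hab : a ≠ b)
    (h : (p.1.support : Set V) ⊆ {a, b}) (φ : V → ℝ) : p.avg φ = p.1 a * φ a + p.1 b * φ b := by
  classical
  have h' : p.1.support ⊆ ({a, b} : Finset V) := by
    intro x hx; simpa using h hx
  rw [Point.avg, Finsupp.linearCombination_apply, Finsupp.sum_of_support_subset _ h' _ (by simp),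
    Finset.sum_pair hab]
  rfl

theorem Point.eq_vertex_of_support {p : Point T} {a : V} (h : (p.1.support : Set V) ⊆ {a}) :
    p = vertex T a := by
  have h' : p.1.support ⊆ ({a} : Finset V) := by
    intro x hx; simpa using h hx
  obtain ⟨c, hc⟩ := Finsupp.support_subset_singleton'.1 h'
  have h1 := p.avg_one
  rw [Point.avg, hc, Finsupp.linearCombination_single] at h1
  simp only [smul_eq_mul, mul_one] at h1
  exact Subtype.ext (by rw [hc, h1]; rfl)

theorem Point.cases (p : Point T) : (∃ v, p = vertex T v) ∨
    ∃ a b t, T.Adj a b ∧ 0 < t ∧ t < 1 ∧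
      p.1 = Finsupp.single a (1 - t) + Finsupp.single b t := by
  obtain ⟨a, b, t, hab, h0, h1, h⟩ := p.2
  rcases hab with rfl | hab
  · left; exact ⟨a, Subtype.ext (by rw [h, ← Finsupp.single_add]; simp [vertex])⟩
  rcases h0.eq_or_lt with rfl | h0
  · left; exact ⟨a, Subtype.ext (by rw [h]; simp [vertex])⟩
  rcases h1.eq_or_lt with rfl | h1
  · left; exact ⟨b, Subtype.ext (by rw [h]; simp [vertex])⟩
  exact Or.inr ⟨a, b, t, hab, h0, h1, h⟩

theorem support_of_edge {p : Point T} {a b : V} {t : ℝ} (hab : a ≠ b) (h0 : 0 < t) (h1 : t < 1)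
    (h : p.1 = Finsupp.single a (1 - t) + Finsupp.single b t) (x : V) :
    x ∈ p.1.support ↔ x = a ∨ x = b := by
  classical
  rw [h, Finsupp.mem_support_iff, Finsupp.add_apply, Finsupp.single_apply, Finsupp.single_apply]
  constructor
  · intro H; by_contra hc
    rw [not_or] at hc
    simp [Ne.symm hc.1, Ne.symm hc.2] at H
  · rintro (rfl | rfl)
    · simp [hab.symm]; linarith
    · simp [hab]; linarith

theorem apply_left_of_edge {p : Point T} {a b : V} {t : ℝ} (hab : a ≠ b)
    (h : p.1 = Finsupp.single a (1 - t) + Finsupp.single b t) : p.1 a = 1 - t := by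
  simp [h, hab]

theorem apply_right_of_edge {p : Point T} {a b : V} {t : ℝ} (hab : a ≠ b)
    (h : p.1 = Finsupp.single a (1 - t) + Finsupp.single b t) : p.1 b = t := by
  simp [h, hab]

theorem vertex_support (v x : V) : x ∈ (vertex T v).1.support ↔ x = v := by
  simp [vertex, eq_comm]

theorem vertex_apply (v : V) : (vertex T v).1 v = 1 := by simp [vertex]

/-- The affine extension of the nearest index on a line. -/
noncomputable def pos (L : ℤ → V) (p : Point T) : ℝ := p.avg fun v => (foot T L v : ℝ)

/-- The affine extension of the distance from a line. -/
noncomputable def off (L : ℤ → V) (p : Point T) : ℝ := p.avg fun v => (height T L v : ℝ)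

theorem pos_vertex (v : V) : pos L (vertex T v) = foot T L v := Point.avg_vertex _ _

theorem off_vertex (v : V) : off L (vertex T v) = height T L v := Point.avg_vertex _ _

theorem IsLine.point_cases (hT : T.IsTree) (hL : IsLine T L) (p : Point T) :
    (∃ v, p = vertex T v) ∨
    (∃ a b t, a ≠ b ∧ foot T L a = foot T L b ∧ height T L b = height T L a + 1 ∧ 0 < t ∧ t < 1 ∧
      p.1 = Finsupp.single a (1 - t) + Finsupp.single b t) ∨
    ∃ k t, 0 < t ∧ t < 1 ∧ p.1 = Finsupp.single (L k) (1 - t) + Finsupp.single (L (k + 1)) t := by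
  rcases p.cases with h | ⟨a, b, t, hab, h0, h1, h⟩
  · exact Or.inl h
  right
  have h' : p.1 = Finsupp.single b (1 - (1 - t)) + Finsupp.single a (1 - t) := by
    rw [h, add_comm]; simp
  rcases hL.adj_cases hT hab with ⟨ha, hb, hf | hf⟩ | ⟨hf, hh | hh⟩
  · right
    refine ⟨foot T L a, t, h0, h1, ?_⟩
    rw [← hf, ← eq_line_foot_of_height_eq_zero hT ha, ← eq_line_foot_of_height_eq_zero hT hb]
    exact h
  · right
    refine ⟨foot T L b, 1 - t, by linarith, by linarith, ?_⟩
    rw [← hf, ← eq_line_foot_of_height_eq_zero hT ha, ← eq_line_foot_of_height_eq_zero hT hb]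
    exact h'
  · left; exact ⟨a, b, t, hab.ne, hf, hh, h0, h1, h⟩
  · left; exact ⟨b, a, 1 - t, hab.ne', hf.symm, hh, by linarith, by linarith, h'⟩

theorem IsLine.pos_off_of_edge (hT : T.IsTree) (hL : IsLine T L) {p : Point T} {k : ℤ} {t : ℝ}
    (h : p.1 = Finsupp.single (L k) (1 - t) + Finsupp.single (L (k + 1)) t) :
    pos L p = k + t ∧ off L p = 0 := by
  constructor
  · rw [pos, Point.avg_of_eq h, hL.foot_line hT, hL.foot_line hT]; push_cast; ring
  · rw [off, Point.avg_of_eq h, hL.height_line hT, hL.height_line hT]; push_cast; ring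

theorem pos_off_of_off_edge {p : Point T} {a b : V} {t : ℝ}
    (hf : foot T L a = foot T L b) (hh : height T L b = height T L a + 1)
    (h : p.1 = Finsupp.single a (1 - t) + Finsupp.single b t) :
    pos L p = foot T L a ∧ off L p = height T L a + t := by
  constructor
  · rw [pos, Point.avg_of_eq h, ← hf]; ring
  · rw [off, Point.avg_of_eq h, hh]; push_cast; ring

theorem off_nonneg (p : Point T) : 0 ≤ off L p := by
  obtain ⟨a, b, t, -, h0, h1, h⟩ := p.2
  rw [off, Point.avg_of_eq h]
  have ha : (0 : ℝ) ≤ height T L a := by exact_mod_cast height_nonneg a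
  have hb : (0 : ℝ) ≤ height T L b := by exact_mod_cast height_nonneg b
  have : 0 ≤ 1 - t := by linarith
  positivity

theorem IsLine.exists_right (hT : T.IsTree) (hL : IsLine T L) (p : Point T) :
    ∃ x ∈ p.1.support, 1 - p.1 x = (off L p - height T L x) + (foot T L x - pos L p) ∧
      foot T L x = ⌈pos L p⌉ := by
  rcases hL.point_cases hT p with ⟨v, rfl⟩ | ⟨a, b, t, hab, hf, hh, h0, h1, h⟩ | ⟨k, t, h0, h1, h⟩
  · refine ⟨v, (vertex_support _ _).2 rfl, ?_, ?_⟩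
    · rw [vertex_apply, pos_vertex, off_vertex]; ring
    · rw [pos_vertex, Int.ceil_intCast]
  · obtain ⟨e1, e2⟩ := pos_off_of_off_edge hf hh h
    refine ⟨a, (support_of_edge hab h0 h1 h _).2 (Or.inl rfl), ?_, ?_⟩
    · rw [apply_left_of_edge hab h, e1, e2]; ring
    · rw [e1, Int.ceil_intCast]
  · obtain ⟨e1, e2⟩ := hL.pos_off_of_edge hT h
    refine ⟨L (k + 1), (support_of_edge (hL.adj k).ne h0 h1 h _).2 (Or.inr rfl), ?_, ?_⟩
    · rw [apply_right_of_edge (hL.adj k).ne h, e1, e2, hL.height_line hT, hL.foot_line hT]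
      push_cast; ring
    · rw [e1, hL.foot_line hT, eq_comm, Int.ceil_eq_iff]
      push_cast
      constructor <;> linarith

theorem IsLine.exists_left (hT : T.IsTree) (hL : IsLine T L) (p : Point T) :
    ∃ x ∈ p.1.support, 1 - p.1 x = (off L p - height T L x) + (pos L p - foot T L x) ∧
      foot T L x = ⌊pos L p⌋ := by
  rcases hL.point_cases hT p with ⟨v, rfl⟩ | ⟨a, b, t, hab, hf, hh, h0, h1, h⟩ | ⟨k, t, h0, h1, h⟩
  · refine ⟨v, (vertex_support _ _).2 rfl, ?_, ?_⟩
    · rw [vertex_apply, pos_vertex, off_vertex]; ring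
    · rw [pos_vertex, Int.floor_intCast]
  · obtain ⟨e1, e2⟩ := pos_off_of_off_edge hf hh h
    refine ⟨a, (support_of_edge hab h0 h1 h _).2 (Or.inl rfl), ?_, ?_⟩
    · rw [apply_left_of_edge hab h, e1, e2]; ring
    · rw [e1, Int.floor_intCast]
  · obtain ⟨e1, e2⟩ := hL.pos_off_of_edge hT h
    refine ⟨L k, (support_of_edge (hL.adj k).ne h0 h1 h _).2 (Or.inl rfl), ?_, ?_⟩
    · rw [apply_left_of_edge (hL.adj k).ne h, e1, e2, hL.height_line hT, hL.foot_line hT]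
      push_cast; ring
    · rw [e1, hL.foot_line hT, eq_comm, Int.floor_eq_iff]
      constructor <;> linarith

theorem IsLine.pos_int_or_edge (hT : T.IsTree) (hL : IsLine T L) (p : Point T) :
    (∃ n : ℤ, pos L p = n) ∨
    ∃ k t, 0 < t ∧ t < 1 ∧ p.1 = Finsupp.single (L k) (1 - t) + Finsupp.single (L (k + 1)) t := by
  rcases hL.point_cases hT p with ⟨v, rfl⟩ | ⟨a, b, t, hab, hf, hh, h0, h1, h⟩ | h
  · exact Or.inl ⟨_, pos_vertex _⟩
  · exact Or.inl ⟨_, (pos_off_of_off_edge hf hh h).1⟩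
  · exact Or.inr h

theorem IsLine.support_bound (hT : T.IsTree) (hL : IsLine T L) (p : Point T) {x : V}
    (hx : x ∈ p.1.support) : |off L p - height T L x| + |pos L p - foot T L x| ≤ 1 - p.1 x ∧
      (pos L p = foot T L x ∨ height T L x = 0) ∧ (off L p = 0 → height T L x = 0) := by
  rcases hL.point_cases hT p with ⟨v, rfl⟩ | ⟨a, b, t, hab, hf, hh, h0, h1, h⟩ | ⟨k, t, h0, h1, h⟩
  · rw [vertex_support] at hx
    subst hx
    simp [pos_vertex, off_vertex, vertex_apply]
  · obtain ⟨e1, e2⟩ := pos_off_of_off_edge hf hh h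
    have ha : (0 : ℝ) ≤ height T L a := by exact_mod_cast height_nonneg a
    rw [support_of_edge hab h0 h1 h] at hx
    rw [e1, e2]
    rcases hx with rfl | rfl
    · rw [apply_left_of_edge hab h]
      refine ⟨?_, Or.inl rfl, fun h => by linarith⟩
      simp [abs_of_pos h0]
    · rw [apply_right_of_edge hab h]
      refine ⟨?_, Or.inl (by rw [hf]), fun h => by linarith⟩
      rw [hh, hf]; push_cast
      rw [abs_of_nonpos (by linarith)]; simp
  · obtain ⟨e1, e2⟩ := hL.pos_off_of_edge hT h
    rw [support_of_edge (hL.adj k).ne h0 h1 h] at hx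
    rw [e1, e2]
    rcases hx with rfl | rfl
    · rw [apply_left_of_edge (hL.adj k).ne h]
      simp [hL.height_line hT, hL.foot_line hT, abs_of_pos h0]
    · rw [apply_right_of_edge (hL.adj k).ne h]
      simp only [hL.height_line hT, hL.foot_line hT, or_true, implies_true, and_true]
      push_cast
      rw [abs_of_nonpos (a := (k : ℝ) + t - (k + 1)) (by linarith)]; simp

theorem pdist_nonneg (p q : Point T) : 0 ≤ pdist p q := by
  refine Real.sInf_nonneg ?_
  rintro r (⟨a, b, -, -, -, rfl⟩ | ⟨x, -, y, -, rfl⟩)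
  · positivity
  · have := p.le_one x
    have := q.le_one y
    have : (0 : ℝ) ≤ T.dist x y := by positivity
    linarith

theorem pdist_le {p q : Point T} {r : ℝ} (h : r ∈ {r : ℝ | ∃ a b : V, (a = b ∨ T.Adj a b) ∧
      (p.1.support : Set V) ⊆ {a, b} ∧ (q.1.support : Set V) ⊆ {a, b} ∧ r = |p.1 a - q.1 a|} ∪
        {r : ℝ | ∃ x ∈ p.1.support, ∃ y ∈ q.1.support,
          r = (1 - p.1 x) + (T.dist x y : ℝ) + (1 - q.1 y)}) : pdist p q ≤ r := by
  refine csInf_le ⟨0, ?_⟩ h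
  rintro r (⟨a, b, -, -, -, rfl⟩ | ⟨x, -, y, -, rfl⟩)
  · positivity
  · have := p.le_one x
    have := q.le_one y
    have : (0 : ℝ) ≤ T.dist x y := by positivity
    linarith

theorem pdist_comm (p q : Point T) : pdist p q = pdist q p := by
  unfold pdist
  congr 1
  ext r
  constructor
  · rintro (⟨a, b, h1, h2, h3, rfl⟩ | ⟨x, hx, y, hy, rfl⟩)
    · exact Or.inl ⟨a, b, h1, h3, h2, abs_sub_comm _ _⟩
    · exact Or.inr ⟨y, hy, x, hx, by rw [SimpleGraph.dist_comm]; ring⟩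
  · rintro (⟨a, b, h1, h2, h3, rfl⟩ | ⟨x, hx, y, hy, rfl⟩)
    · exact Or.inl ⟨a, b, h1, h3, h2, abs_sub_comm _ _⟩
    · exact Or.inr ⟨y, hy, x, hx, by rw [SimpleGraph.dist_comm]; ring⟩

theorem IsLine.pdist_le (hT : T.IsTree) (hL : IsLine T L) (p q : Point T) :
    pdist p q ≤ off L p + |pos L p - pos L q| + off L q := by
  wlog hle : pos L p ≤ pos L q generalizing p q
  · rw [pdist_comm, abs_sub_comm]
    linarith [this q p (le_of_not_ge hle)]
  rw [abs_sub_comm, abs_of_nonneg (sub_nonneg.2 hle)]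
  by_cases hc : ⌈pos L p⌉ ≤ ⌊pos L q⌋
  · obtain ⟨x, hx, hx1, hx2⟩ := hL.exists_right hT p
    obtain ⟨y, hy, hy1, hy2⟩ := hL.exists_left hT q
    refine (TreeAut.pdist_le (Or.inr ⟨x, hx, y, hy, rfl⟩)).trans ?_
    have h1 := hL.dist_le hT x y
    rw [abs_sub_comm, abs_of_nonneg (by omega)] at h1
    have h2 : (T.dist x y : ℝ) ≤
        height T L x + (foot T L y - foot T L x) + height T L y := by exact_mod_cast h1
    linarith
  · rcases hL.pos_int_or_edge hT p with ⟨n, hn⟩ | ⟨k, t, h0, h1, h⟩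
    · rw [hn] at hc hle
      exact absurd (by rw [Int.ceil_intCast]; exact Int.le_floor.2 hle) hc
    rcases hL.pos_int_or_edge hT q with ⟨n, hn⟩ | ⟨k', s, h0', h1', h'⟩
    · rw [hn] at hc hle
      exact absurd (by rw [Int.floor_intCast]; exact Int.ceil_le.2 hle) hc
    obtain ⟨e1, e2⟩ := hL.pos_off_of_edge hT h
    obtain ⟨e1', e2'⟩ := hL.pos_off_of_edge hT h'
    rw [e1, e1'] at hc hle
    have hk : k = k' := by
      have l1 : k < k' + 1 := by
        have : (k : ℝ) < k' + 1 := by linarith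
        exact_mod_cast this
      have l2 : k' < k + 1 := by
        by_contra hcc
        refine hc ((Int.ceil_le.2 (?_ : _ ≤ ((k + 1 : ℤ) : ℝ))).trans
          ((not_lt.1 hcc).trans (Int.le_floor.2 ?_)))
        · push_cast; linarith
        · linarith
      omega
    subst hk
    refine (TreeAut.pdist_le (Or.inl ⟨L k, L (k + 1), Or.inr (hL.adj k), ?_, ?_, rfl⟩)).trans ?_
    · exact fun x hx => (support_of_edge (hL.adj k).ne h0 h1 h x).1 hx
    · exact fun x hx => (support_of_edge (hL.adj k).ne h0' h1' h' x).1 hx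
    · rw [apply_left_of_edge (hL.adj k).ne h, apply_left_of_edge (hL.adj k).ne h', e1, e2, e1', e2',
        abs_of_nonneg (by linarith)]
      linarith

theorem Point.support_nonempty (p : Point T) : p.1.support.Nonempty := by
  rw [Finsupp.support_nonempty_iff]
  intro h
  have := p.avg_one
  simp [Point.avg, h] at this

theorem IsLine.le_pdist (hT : T.IsTree) (hL : IsLine T L) (p q : Point T)
    (H : pos L p ≠ pos L q ∨ off L p = 0 ∨ off L q = 0) :
    off L p + |pos L p - pos L q| + off L q ≤ pdist p q := by
  refine le_csInf ?_ ?_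
  · obtain ⟨x, hx⟩ := p.support_nonempty
    obtain ⟨y, hy⟩ := q.support_nonempty
    exact ⟨_, Or.inr ⟨x, hx, y, hy, rfl⟩⟩
  rintro r (⟨a, b, hab, hp, hq, rfl⟩ | ⟨x, hx, y, hy, rfl⟩)
  · rcases hab with rfl | hab
    · have e1 := Point.eq_vertex_of_support (a := a) (by simpa using hp)
      have e2 := Point.eq_vertex_of_support (a := a) (by simpa using hq)
      subst e1; rw [e2] at H ⊢
      simp only [ne_eq, not_true_eq_false, false_or, or_self] at H
      simp [H]
    · have p1 := p.avg_one
      have q1 := q.avg_one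
      have l1 := p.nonneg a
      have l2 := p.nonneg b
      have l3 := q.nonneg a
      have l4 := q.nonneg b
      have ha : (0 : ℝ) ≤ height T L a := by exact_mod_cast height_nonneg a
      have hb : (0 : ℝ) ≤ height T L b := by exact_mod_cast height_nonneg b
      rw [Point.avg_of_support hab.ne hp] at p1
      rw [Point.avg_of_support hab.ne hq] at q1
      simp only [pos, off, Point.avg_of_support hab.ne hp, Point.avg_of_support hab.ne hq] at H ⊢
      have p2 : p.1 b = 1 - p.1 a := by linarith
      have q2 : q.1 b = 1 - q.1 a := by linarith
      rw [p2] at l2; rw [q2] at l4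
      rw [p2, q2] at H ⊢
      rcases hL.adj_cases hT hab with ⟨e1, e2, hf | hf⟩ | ⟨hf, hh | hh⟩
      · rw [e1, e2, hf]; push_cast
        rw [← abs_neg (p.1 a - q.1 a)]
        ring_nf; rfl
      · rw [e1, e2, hf]; push_cast
        ring_nf; rfl
      · rw [← hf, hh] at H ⊢
        push_cast at H ⊢
        have : ∀ c : ℝ, c * foot T L a + (1 - c) * foot T L a = foot T L a := fun c => by ring
        simp only [this, ne_eq, not_true_eq_false, false_or, sub_self, abs_zero] at H ⊢
        rcases H with H | H
        · have : (1 - p.1 a) = 0 ∧ (height T L a : ℝ) = 0 := by constructor <;> nlinarith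
          rw [this.2, abs_of_nonneg (by linarith)]; nlinarith
        · have : (1 - q.1 a) = 0 ∧ (height T L a : ℝ) = 0 := by constructor <;> nlinarith
          rw [this.2, abs_of_nonpos (by linarith)]; nlinarith
      · rw [← hf, hh] at H ⊢
        push_cast at H ⊢
        have : ∀ c : ℝ, c * foot T L a + (1 - c) * foot T L a = foot T L a := fun c => by ring
        simp only [this, ne_eq, not_true_eq_false, false_or, sub_self, abs_zero] at H ⊢
        rcases H with H | H
        · have : (p.1 a) = 0 ∧ (height T L b : ℝ) = 0 := by constructor <;> nlinarith
          rw [this.2, abs_of_nonpos (by linarith)]; nlinarith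
        · have : (q.1 a) = 0 ∧ (height T L b : ℝ) = 0 := by constructor <;> nlinarith
          rw [this.2, abs_of_nonneg (by linarith)]; nlinarith
  · obtain ⟨bx, cx, dx⟩ := hL.support_bound hT p hx
    obtain ⟨by', cy, dy⟩ := hL.support_bound hT q hy
    have key : height T L x + |foot T L x - foot T L y| + height T L y ≤ (T.dist x y : ℤ) := by
      by_cases hf : foot T L x = foot T L y
      · have h0 : height T L x = 0 ∨ height T L y = 0 := by
          rcases H with H | H | H
          · rcases cx with cx | cx
            · rcases cy with cy | cy
              · exact absurd (by rw [cx, cy, hf]) H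
              · exact Or.inr cy
            · exact Or.inl cx
          · exact Or.inl (dx H)
          · exact Or.inr (dy H)
        have := hL.abs_height_sub_le hT x y
        rw [abs_le] at this
        rw [hf, sub_self, abs_zero]
        rcases h0 with h0 | h0 <;> omega
      · exact hL.le_dist hT hf
    have key' : (height T L x : ℝ) + |(foot T L x : ℝ) - foot T L y| + height T L y
        ≤ (T.dist x y : ℝ) := by exact_mod_cast key
    have t1 := abs_sub_le (pos L p) (foot T L x) (pos L q)
    have t2 := abs_sub_le (foot T L x : ℝ) (foot T L y) (pos L q)
    rw [abs_sub_comm (foot T L y : ℝ)] at t2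
    linarith [le_abs_self (off L p - height T L x), le_abs_self (off L q - height T L y)]

theorem IsLine.pdist_eq (hT : T.IsTree) (hL : IsLine T L) (p q : Point T)
    (H : pos L p ≠ pos L q ∨ off L p = 0 ∨ off L q = 0) :
    pdist p q = off L p + |pos L p - pos L q| + off L q :=
  le_antisymm (hL.pdist_le hT p q) (hL.le_pdist hT p q H)

/-- The point of a line at a real parameter. -/
noncomputable def IsLine.point (hL : IsLine T L) (x : ℝ) : Point T :=
  ⟨Finsupp.single (L ⌊x⌋) (1 - Int.fract x) + Finsupp.single (L (⌊x⌋ + 1)) (Int.fract x),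
    _, _, _, Or.inr (hL.adj _), Int.fract_nonneg x, (Int.fract_lt_one x).le, rfl⟩

theorem IsLine.pos_point (hT : T.IsTree) (hL : IsLine T L) (x : ℝ) : pos L (hL.point x) = x := by
  rw [(hL.pos_off_of_edge hT (p := hL.point x) rfl).1, Int.floor_add_fract]

theorem IsLine.off_point (hT : T.IsTree) (hL : IsLine T L) (x : ℝ) : off L (hL.point x) = 0 :=
  (hL.pos_off_of_edge hT (p := hL.point x) rfl).2

theorem IsLine.point_int (hL : IsLine T L) (n : ℤ) : hL.point n = vertex T (L n) :=
  Subtype.ext (by simp [IsLine.point, vertex])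

theorem IsLine.eq_point (hT : T.IsTree) (hL : IsLine T L) {p : Point T} (h0 : off L p = 0) :
    p = hL.point (pos L p) := by
  rcases hL.point_cases hT p with ⟨v, rfl⟩ | ⟨a, b, t, hab, hf, hh, h1, h2, h⟩ | ⟨k, t, h1, h2, h⟩
  · rw [off_vertex] at h0
    have e := eq_line_foot_of_height_eq_zero (T := T) (L := L) hT (v := v) (by exact_mod_cast h0)
    rw [pos_vertex, hL.point_int, ← e]
  · have := (pos_off_of_off_edge hf hh h).2
    have ha : (0 : ℝ) ≤ height T L a := by exact_mod_cast height_nonneg a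
    linarith
  · rw [(hL.pos_off_of_edge hT h).1]
    have e1 : ⌊(k : ℝ) + t⌋ = k := by
      rw [Int.floor_eq_iff]; constructor <;> linarith
    have e2 : Int.fract ((k : ℝ) + t) = t := by rw [Int.fract, e1]; ring
    exact Subtype.ext (by rw [h]; simp [IsLine.point, e1, e2])

theorem IsLine.point_ext (hT : T.IsTree) (hL : IsLine T L) {p q : Point T} (hp : off L p = 0)
    (hq : off L q = 0) (h : pos L p = pos L q) : p = q := by
  rw [hL.eq_point hT hp, hL.eq_point hT hq, h]

end

section

variable {V : Type*} {T : SimpleGraph V} {L : ℤ → V} {v₀ : V}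

theorem Point.avg_mul_add (p : Point T) (φ : V → ℝ) (a b : ℝ) :
    p.avg (fun v => a * φ v + b) = a * p.avg φ + b := by
  obtain ⟨x, y, t, -, -, -, h⟩ := p.2
  rw [Point.avg_of_eq h, Point.avg_of_eq h]; ring

theorem act_vertex (g : T ≃g T) (v : V) : act g (vertex T v) = vertex T (g v) :=
  Subtype.ext (by simp [act, vertex])

theorem pdist_self (p : Point T) : pdist p p = 0 := by
  refine le_antisymm ?_ (pdist_nonneg p p)
  have key : ∃ a b, (a = b ∨ T.Adj a b) ∧ (p.1.support : Set V) ⊆ {a, b} := by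
    rcases p.cases with ⟨v, rfl⟩ | ⟨a, b, t, hab, h0, h1, h⟩
    · exact ⟨v, v, Or.inl rfl, fun x hx => Or.inl ((vertex_support v x).1 hx)⟩
    · exact ⟨a, b, Or.inr hab, fun x hx => (support_of_edge hab.ne h0 h1 h x).1 hx⟩
  obtain ⟨a, b, hab, hs⟩ := key
  exact pdist_le (Or.inl ⟨a, b, hab, hs, hs, by simp⟩)

theorem translationLength_le (g : T ≃g T) (p : Point T) :
    translationLength g ≤ pdist p (act g p) :=
  ciInf_le ⟨0, by rintro _ ⟨w, rfl⟩; exact pdist_nonneg _ _⟩ p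

theorem IsHyperbolic.act_ne {g : T ≃g T} (hg : IsHyperbolic g) (p : Point T) : act g p ≠ p := by
  intro h
  have := translationLength_le g p
  rw [h, pdist_self] at this
  exact absurd hg (not_lt.2 this)

theorem IsHyperbolic.apply_ne {g : T ≃g T} (hg : IsHyperbolic g) (v : V) : g v ≠ v := fun h =>
  hg.act_ne (vertex T v) (by rw [act_vertex, h])

theorem IsHyperbolic.exists_isAxis (hT : T.IsTree) {g : T ≃g T} (hg : IsHyperbolic g) :
    ∃ L l, IsAxis g L l := by
  refine TreeAut.exists_isAxis hT g hg.apply_ne fun v hv h => ?_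
  refine hg.act_ne ⟨Finsupp.single v (1 - 1 / 2) + Finsupp.single (g v) (1 / 2), v, g v, 1 / 2,
    Or.inr hv, by norm_num, by norm_num, rfl⟩ (Subtype.ext ?_)
  simp only [act, Finsupp.mapDomain_add, Finsupp.mapDomain_single, h]
  rw [add_comm]; norm_num

theorem isHyperbolic_of_not_isElliptic {g : T ≃g T} (hg : ¬ IsElliptic g) : IsHyperbolic g :=
  lt_of_le_of_ne (Real.iInf_nonneg fun _ => pdist_nonneg _ _) (Ne.symm hg)

theorem IsHyperbolic.not_isElliptic {g : T ≃g T} (hg : IsHyperbolic g) : ¬ IsElliptic g :=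
  hg.ne'

section Axis

variable {g : T ≃g T} {l : ℤ}

theorem IsAxis.pos_act (hT : T.IsTree) (hL : IsAxis g L l) (p : Point T) :
    pos L (act g p) = pos L p + l := by
  have := p.avg_mul_add (fun v => (foot T L v : ℝ)) 1 l
  rw [one_mul] at this
  rw [pos, Point.avg_act, pos, ← this]
  congr 1
  funext v
  rw [hL.foot_map hT]; push_cast; ring

theorem IsAxis.off_act (hT : T.IsTree) (hL : IsAxis g L l) (p : Point T) :
    off L (act g p) = off L p := by
  rw [off, Point.avg_act, off]
  congr 1
  funext v
  rw [hL.height_map hT]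

theorem IsAxis.pdist_act (hT : T.IsTree) (hL : IsAxis g L l) (p : Point T) :
    pdist p (act g p) = 2 * off L p + |(l : ℝ)| := by
  have h0 : (l : ℝ) ≠ 0 := by exact_mod_cast hL.ne_zero
  rw [hL.pdist_eq hT _ _ (Or.inl (by rw [hL.pos_act hT]; intro h; apply h0; linarith)),
    hL.pos_act hT, hL.off_act hT, sub_add_cancel_left, abs_neg]
  ring

theorem IsAxis.translationLength_eq (hT : T.IsTree) (hL : IsAxis g L l) :
    translationLength g = |(l : ℝ)| := by
  refine le_antisymm ?_ ?_
  · refine (translationLength_le g (hL.point 0)).trans ?_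
    rw [hL.pdist_act hT, hL.off_point hT]; simp
  · have : Nonempty (Point T) := ⟨hL.point 0⟩
    refine le_ciInf fun p => ?_
    rw [hL.pdist_act hT]
    linarith [off_nonneg (L := L) p]

theorem IsAxis.mem_minSet (hT : T.IsTree) (hL : IsAxis g L l) (p : Point T) :
    p ∈ minSet g ↔ off L p = 0 := by
  rw [minSet, Set.mem_ofPred_eq, hL.translationLength_eq hT, hL.pdist_act hT]
  constructor <;> intro h <;> linarith

theorem IsAxis.minSet_inv (hT : T.IsTree) (hL : IsAxis g L l) : minSet g⁻¹ = minSet g := by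
  ext p
  rw [hL.mem_minSet hT, hL.inv.mem_minSet hT]

theorem IsAxis.translationLength_inv (hT : T.IsTree) (hL : IsAxis g L l) :
    translationLength g⁻¹ = translationLength g := by
  rw [hL.translationLength_eq hT, hL.inv.translationLength_eq hT]; simp

theorem IsAxis.proj_eq (hT : T.IsTree) (hL : IsAxis g L l) (w : Point T) :
    proj (minSet g) w = hL.point (pos L w) := by
  have hd : ∀ b ∈ minSet g, pdist w b = off L w + |pos L w - pos L b| := fun b hb => by
    have hb' := (hL.mem_minSet hT b).1 hb
    rw [hL.pdist_eq hT _ _ (Or.inr (Or.inr hb')), hb', add_zero]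
  have hm : hL.point (pos L w) ∈ minSet g := (hL.mem_minSet hT _).2 (hL.off_point hT _)
  have h : ∃ a ∈ minSet g, ∀ b ∈ minSet g, pdist w a ≤ pdist w b := by
    refine ⟨_, hm, fun b hb => ?_⟩
    rw [hd _ hm, hd b hb, hL.pos_point hT, sub_self, abs_zero]
    linarith [abs_nonneg (pos L w - pos L b)]
  rw [proj, dif_pos h]
  obtain ⟨h1, h2⟩ := h.choose_spec
  have h3 := h2 _ hm
  rw [hd _ hm, hd _ h1, hL.pos_point hT, sub_self, abs_zero] at h3
  have h4 : |pos L w - pos L h.choose| = 0 := by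
    linarith [abs_nonneg (pos L w - pos L h.choose)]
  have h5 := abs_eq_zero.1 h4
  exact hL.point_ext hT ((hL.mem_minSet hT _).1 h1) (hL.off_point hT _)
    (by rw [hL.pos_point hT]; linarith)

theorem IsAxis.center_eq (hT : T.IsTree) (hL : IsAxis g L l) :
    center v₀ g = vertex T (L (foot T L v₀)) := by
  rw [center, hL.proj_eq hT, pos_vertex, hL.point_int]

theorem IsAxis.pdist_center (hT : T.IsTree) (hL : IsAxis g L l) {p : Point T} (hp : off L p = 0) :
    pdist (center v₀ g) p = |pos L p - foot T L v₀| := by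
  rw [hL.center_eq hT, hL.pdist_eq hT _ _ (Or.inr (Or.inr hp)), hp, off_vertex, pos_vertex,
    hL.foot_line hT, hL.height_line hT, abs_sub_comm]
  simp

theorem IsAxis.mem_segment (hT : T.IsTree) (hL : IsAxis g L l) {p q : Point T} (hp : off L p = 0)
    (hq : off L q = 0) (hpq : pos L p ≤ pos L q) (w : Point T) :
    w ∈ segment p q ↔ off L w = 0 ∧ pos L p ≤ pos L w ∧ pos L w ≤ pos L q := by
  rw [segment, Set.mem_ofPred_eq, hL.pdist_eq hT p w (Or.inr (Or.inl hp)),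
    hL.pdist_eq hT w q (Or.inr (Or.inr hq)), hL.pdist_eq hT p q (Or.inr (Or.inl hp)), hp, hq,
    abs_sub_comm (pos L p) (pos L q), abs_of_nonneg (sub_nonneg.2 hpq)]
  have h0 := off_nonneg (L := L) w
  constructor
  · intro h
    have := neg_abs_le (pos L p - pos L w)
    have := neg_abs_le (pos L w - pos L q)
    have := le_abs_self (pos L p - pos L w)
    have := le_abs_self (pos L w - pos L q)
    refine ⟨by linarith, by linarith, by linarith⟩
  · rintro ⟨h1, h2, h3⟩
    rw [abs_of_nonpos (by linarith), abs_of_nonpos (by linarith)]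
    linarith

end Axis

theorem pos_affine (hT : T.IsTree) (hL : IsLine T L) (ε c : ℤ) (hε : ε = 1 ∨ ε = -1)
    (p : Point T) : pos (fun i => L (c + ε * i)) p = ε * (pos L p - c) := by
  have := p.avg_mul_add (fun v => (foot T L v : ℝ)) ε (-(ε * c))
  rw [pos, pos, mul_sub, sub_eq_add_neg, ← this]
  congr 1
  funext v
  rw [foot_affine hT hL ε c hε]; push_cast; ring

/-! ### The order on vertices -/

theorem pathFrom_ext (hT : T.IsTree) {P Q : PathFrom T v₀} (h : P.1 = Q.1) : P = Q := by
  obtain ⟨v, P⟩ := P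
  obtain ⟨w, Q⟩ := Q
  obtain rfl : v = w := h
  rw [(hT.isAcyclic.subsingleton_path v₀ v).elim P Q]

theorem exists_pathFrom (hT : T.IsTree) (v : V) : ∃ P : PathFrom T v₀, P.1 = v := by
  obtain ⟨p, hp⟩ := hT.connected.exists_walk_length_eq_dist v₀ v
  exact ⟨⟨v, p, p.isPath_of_length_eq_dist hp⟩, rfl⟩

theorem length_pathFrom (hT : T.IsTree) (P : PathFrom T v₀) : P.length = T.dist v₀ P.1 := by
  obtain ⟨p, hp⟩ := hT.connected.exists_walk_length_eq_dist v₀ P.1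
  rw [← hp]
  exact congrArg PathFrom.length
    (pathFrom_ext (P := P) (Q := ⟨P.1, p, p.isPath_of_length_eq_dist hp⟩) hT rfl)

theorem mem_support_pathFrom (hT : T.IsTree) (P : PathFrom T v₀) {w : V}
    (hw : T.dist v₀ w + T.dist w P.1 = T.dist v₀ P.1) : w ∈ (P.2 : T.Walk v₀ P.1).support := by
  obtain ⟨p, hp⟩ := hT.connected.exists_walk_length_eq_dist v₀ w
  obtain ⟨q, hq⟩ := hT.connected.exists_walk_length_eq_dist w P.1
  have h : (p.append q).IsPath :=
    Walk.isPath_of_length_eq_dist _ (by rw [Walk.length_append]; omega)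
  rw [(hT.isAcyclic.subsingleton_path v₀ P.1).elim P.2 ⟨p.append q, h⟩]
  simp

theorem dist_of_mem_support (hT : T.IsTree) (P : PathFrom T v₀) {w : V}
    (hw : w ∈ (P.2 : T.Walk v₀ P.1).support) :
    T.dist v₀ w + T.dist w P.1 = T.dist v₀ P.1 := by
  classical
  have h1 := SimpleGraph.dist_le ((P.2 : T.Walk v₀ P.1).takeUntil w hw)
  have h2 := SimpleGraph.dist_le ((P.2 : T.Walk v₀ P.1).dropUntil w hw)
  have h3 := length_pathFrom hT P
  have h4 := congrArg Walk.length ((P.2 : T.Walk v₀ P.1).take_spec hw)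
  rw [Walk.length_append] at h4
  have h5 := hT.connected.dist_triangle (u := v₀) (v := w) (w := P.1)
  unfold PathFrom.length at h3
  omega

/-- The order of the vertices induced by the order of the paths from `v₀`. -/
def VertexLT (O : LexPathOrder T v₀) (v w : V) : Prop :=
  ∃ P Q : PathFrom T v₀, P.1 = v ∧ Q.1 = w ∧ O.lt P Q

theorem vertexLT_iff (hT : T.IsTree) (O : LexPathOrder T v₀) (P Q : PathFrom T v₀) :
    VertexLT O P.1 Q.1 ↔ O.lt P Q := by
  refine ⟨?_, fun h => ⟨P, Q, rfl, rfl, h⟩⟩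
  rintro ⟨P', Q', hP, hQ, h⟩
  rwa [pathFrom_ext hT hP, pathFrom_ext hT hQ] at h

theorem vertexLT_wellFounded (hT : T.IsTree) (O : LexPathOrder T v₀) :
    WellFounded (VertexLT O) := by
  have := O.isWellOrder
  have wf : WellFounded O.lt := IsWellFounded.wf
  choose f hf using exists_pathFrom (v₀ := v₀) hT
  refine Subrelation.wf (r := InvImage O.lt f) ?_ (InvImage.wf f wf)
  intro v w h
  rw [← hf v, ← hf w] at h
  exact (vertexLT_iff hT O _ _).1 h

theorem vertexLT_irrefl (hT : T.IsTree) (O : LexPathOrder T v₀) (v : V) : ¬ VertexLT O v v :=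
  fun h => (vertexLT_wellFounded hT O).asymmetric _ _ h h

theorem vertexLT_or (hT : T.IsTree) (O : LexPathOrder T v₀) {v w : V} (h : v ≠ w) :
    VertexLT O v w ∨ VertexLT O w v := by
  have := O.isWellOrder
  obtain ⟨P, rfl⟩ := exists_pathFrom (v₀ := v₀) hT v
  obtain ⟨Q, rfl⟩ := exists_pathFrom (v₀ := v₀) hT w
  rw [vertexLT_iff hT, vertexLT_iff hT]
  rcases trichotomous_of O.lt P Q with h' | h' | h'
  · exact Or.inl h'
  · exact absurd (congrArg _ h') h
  · exact Or.inr h'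

theorem vertexLT_of_dist_lt (hT : T.IsTree) (O : LexPathOrder T v₀) {v w : V}
    (h : T.dist v₀ v < T.dist v₀ w) : VertexLT O v w := by
  obtain ⟨P, rfl⟩ := exists_pathFrom (v₀ := v₀) hT v
  obtain ⟨Q, rfl⟩ := exists_pathFrom (v₀ := v₀) hT w
  rw [vertexLT_iff hT]
  exact O.lt_of_length_lt _ _ (by rwa [length_pathFrom hT, length_pathFrom hT])

theorem initial_fst (hT : T.IsTree) (P : PathFrom T v₀) {w : V}
    (hw : T.dist v₀ w + T.dist w P.1 = T.dist v₀ P.1) : (P.initial (T.dist v₀ w)).1 = w := by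
  classical
  have h1 := mem_support_pathFrom hT P hw
  obtain ⟨n, hn, hl⟩ := Walk.mem_support_iff_exists_getVert.1 h1
  have h2 := length_pathFrom hT (P.initial n)
  have h3 : (P.initial n).1 = w := hn
  have h4 : (P.initial n).length = n := by
    show ((P.2 : T.Walk v₀ P.1).take n).length = n
    rw [Walk.take_length]; omega
  rw [h3, h4] at h2
  rw [← h2]; exact hn

/-- The lexicographic property of the order of the vertices. -/
theorem vertexLT_of_between (hT : T.IsTree) (O : LexPathOrder T v₀) {v w v' w' : V}
    (hvw : T.dist v₀ v = T.dist v₀ w) (hvw' : T.dist v₀ v' = T.dist v₀ w')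
    (hv : T.dist v₀ v' + T.dist v' v = T.dist v₀ v) (hw : T.dist v₀ w' + T.dist w' w = T.dist v₀ w)
    (h : VertexLT O v' w') : VertexLT O v w := by
  by_cases h0 : T.dist v' v = 0
  · have e1 := hT.connected.dist_eq_zero_iff.1 h0
    have e2 : w' = w := hT.connected.dist_eq_zero_iff.1 (by omega)
    rwa [e1, e2] at h
  obtain ⟨P, rfl⟩ := exists_pathFrom (v₀ := v₀) hT v
  obtain ⟨Q, rfl⟩ := exists_pathFrom (v₀ := v₀) hT w
  rw [vertexLT_iff hT]
  refine O.lt_of_initial_lt P Q ?_ (T.dist v₀ v') ?_ ?_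
  · rw [length_pathFrom hT, length_pathFrom hT, hvw]
  · rw [length_pathFrom hT]; omega
  · rw [← vertexLT_iff hT, initial_fst hT P hv, hvw', initial_fst hT Q hw]
    exact h

theorem Covers.dist_lt (hT : T.IsTree) {P : PathFrom T v₀} {p : Point T} (h : Covers P p) {x : V}
    (hx : x ∈ p.1.support) (hne : x ≠ P.1) : T.dist v₀ x < T.dist v₀ P.1 := by
  have h1 := dist_of_mem_support hT P (h.2 x hx)
  have := hT.connected.pos_dist_of_ne hne
  omega

theorem Covers.unique (hT : T.IsTree) {P Q : PathFrom T v₀} {p : Point T} (hP : Covers P p)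
    (hQ : Covers Q p) : P = Q := by
  refine pathFrom_ext hT ?_
  by_contra hne
  have h1 := hP.dist_lt hT hQ.1 (Ne.symm hne)
  have h2 := hQ.dist_lt hT hP.1 hne
  omega

theorem exists_covers (hT : T.IsTree) (p : Point T) : ∃ P : PathFrom T v₀, Covers P p := by
  rcases p.cases with ⟨v, rfl⟩ | ⟨a, b, t, hab, h0, h1, h⟩
  · obtain ⟨P, rfl⟩ := exists_pathFrom (v₀ := v₀) hT v
    refine ⟨P, (vertex_support _ _).2 rfl, fun x hx => ?_⟩
    rw [(vertex_support _ _).1 hx]; simp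
  · have key : ∀ a b, T.Adj a b → (∀ x, x ∈ p.1.support ↔ x = a ∨ x = b) →
        T.dist v₀ b = T.dist v₀ a + 1 → ∃ P : PathFrom T v₀, Covers P p := by
      intro a b hab hs hd
      obtain ⟨P, rfl⟩ := exists_pathFrom (v₀ := v₀) hT b
      refine ⟨P, (hs _).2 (Or.inr rfl), fun x hx => ?_⟩
      rcases (hs _).1 hx with rfl | rfl
      · exact mem_support_pathFrom hT P (by rw [dist_eq_one_iff_adj.2 hab, hd])
      · simp
    have hs := support_of_edge hab.ne h0 h1 h
    rcases hT.dist_eq_dist_add_one_of_adj v₀ hab with hd | hd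
    · exact key b a hab.symm (fun x => by rw [hs, or_comm]) hd
    · exact key a b hab hs hd

theorem IsLine.covers_right (hT : T.IsTree) (hL : IsLine T L) {P : PathFrom T v₀} {p : Point T}
    (hP : Covers P p) (h0 : off L p = 0) (hf : foot T L v₀ = 0) (hp : 0 < pos L p) :
    P.1 = L ⌈pos L p⌉ := by
  obtain ⟨x, hx, -, hx2⟩ := hL.exists_right hT p
  have hxh := (hL.support_bound hT p hx).2.2 h0
  have hxL := eq_line_foot_of_height_eq_zero hT hxh
  rw [hx2] at hxL
  rw [← hxL]
  by_contra hne
  have hlt := hP.dist_lt hT hx (Ne.symm hne)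
  obtain ⟨b1, -, b2⟩ := hL.support_bound hT p hP.1
  have hyh := b2 h0
  have hyL := eq_line_foot_of_height_eq_zero hT hyh
  rw [h0, hyh] at b1
  have hpos : 0 < p.1 P.1 := lt_of_le_of_ne (p.nonneg _) (Ne.symm (Finsupp.mem_support_iff.1 hP.1))
  simp only [Int.cast_zero, sub_self, abs_zero, zero_add] at b1
  have b3 := abs_le.1 b1
  have l1 : -1 < foot T L P.1 := by
    have : ((-1 : ℤ) : ℝ) < foot T L P.1 := by push_cast; linarith
    exact_mod_cast this
  have l2 : foot T L P.1 < ⌈pos L p⌉ + 1 := by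
    have : (foot T L P.1 : ℝ) < ⌈pos L p⌉ + 1 := by linarith [Int.le_ceil (pos L p)]
    exact_mod_cast this
  have d1 := hL.dist_eq hT v₀ (foot T L P.1)
  have d2 := hL.dist_eq hT v₀ ⌈pos L p⌉
  rw [← hyL, hf, sub_zero, abs_of_nonneg (by omega)] at d1
  rw [← hxL, hf, sub_zero, abs_of_nonneg (by omega)] at d2
  omega

theorem IsLine.covers_left (hT : T.IsTree) (hL : IsLine T L) {P : PathFrom T v₀} {p : Point T}
    (hP : Covers P p) (h0 : off L p = 0) (hf : foot T L v₀ = 0) (hp : pos L p < 0) :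
    P.1 = L ⌊pos L p⌋ := by
  have hL' := hL.affine (-1) 0 (Or.inr rfl)
  have hpos := pos_affine hT hL (-1) 0 (Or.inr rfl) p
  have hoff : off (fun i => L (0 + -1 * i)) p = 0 := by
    obtain ⟨x, hx⟩ : ∃ x, p = hL.point x := ⟨_, hL.eq_point hT h0⟩
    have hh : ∀ i, height T (fun i => L (0 + -1 * i)) (L i) = 0 := fun i => by
      have := hL'.height_line hT (-i)
      simpa using this
    rw [off, Point.avg_of_eq (show p.1 = _ by rw [hx]; rfl), hh, hh]; simp
  have hfoot := foot_affine hT hL (-1) 0 (Or.inr rfl) v₀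
  have := hL'.covers_right hT hP hoff (by rw [hfoot, hf]; simp) (by rw [hpos]; push_cast; linarith)
  rw [this, hpos]
  simp only [zero_add, Int.reduceNeg, Int.cast_neg, Int.cast_one, Int.cast_zero, sub_zero, neg_mul,
    one_mul, Int.ceil_neg, neg_neg]

/-! ### Fundamental intervals -/

/-- An axis of `g`, parametrised so that `v₀` projects to the origin and the end `u⁺` of the
fundamental interval is on the positive side. -/
structure IsNormalAxis (O : LexPathOrder T v₀) (g : T ≃g T) (L : ℤ → V) (l : ℤ) : Prop
    extends IsAxis g L l where
  foot_base : foot T L v₀ = 0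
  UZero_eq : UZero O g = {p | off L p = 0 ∧ -(|(l : ℝ)| / 2) < pos L p ∧ pos L p ≤ |(l : ℝ)| / 2}
  lt : ∀ m, |l| = 2 * m → VertexLT O (L m) (L (-m))

theorem pointLT_irrefl (hT : T.IsTree) (O : LexPathOrder T v₀) (p : Point T) :
    ¬ O.pointLT p p := by
  rintro (h | ⟨-, P, Q, hP, hQ, h⟩)
  · exact lt_irrefl _ h
  · rw [hP.unique hT hQ, ← vertexLT_iff hT] at h
    exact vertexLT_irrefl hT O _ h

section

variable {O : LexPathOrder T v₀} {g : T ≃g T} {l : ℤ}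

theorem IsAxis.isEnds_iff (hT : T.IsTree) (hL : IsAxis g L l) (hf : foot T L v₀ = 0)
    (u : Point T × Point T) : IsEnds O g u ↔ off L u.1 = 0 ∧ off L u.2 = 0 ∧
      |pos L u.1| = |(l : ℝ)| / 2 ∧ |pos L u.2| = |(l : ℝ)| / 2 ∧ O.pointLT u.2 u.1 := by
  rw [IsEnds, hL.mem_minSet hT, hL.mem_minSet hT, hL.translationLength_eq hT]
  refine and_congr_right fun h1 => and_congr_right fun h2 => ?_
  rw [hL.pdist_center hT h1, hL.pdist_center hT h2, hf]
  simp

theorem IsAxis.exists_isEnds (hT : T.IsTree) (hL : IsAxis g L l) (hf : foot T L v₀ = 0) :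
    ∃ u, IsEnds O g u := by
  have hl : 0 < |(l : ℝ)| / 2 := by
    have : (l : ℝ) ≠ 0 := by exact_mod_cast hL.ne_zero
    positivity
  set a := hL.point (|(l : ℝ)| / 2) with ha
  set b := hL.point (-(|(l : ℝ)| / 2)) with hb
  have pa : pos L a = |(l : ℝ)| / 2 := hL.pos_point hT _
  have pb : pos L b = -(|(l : ℝ)| / 2) := hL.pos_point hT _
  have oa : off L a = 0 := hL.off_point hT _
  have ob : off L b = 0 := hL.off_point hT _
  obtain ⟨P, hP⟩ := exists_covers (v₀ := v₀) hT a
  obtain ⟨Q, hQ⟩ := exists_covers (v₀ := v₀) hT b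
  have e1 := hL.covers_right hT hP oa hf (by rw [pa]; exact hl)
  have e2 := hL.covers_left hT hQ ob hf (by rw [pb]; linarith)
  have hd : pdist (vertex T v₀) a = pdist (vertex T v₀) b := by
    rw [hL.pdist_eq hT _ _ (Or.inr (Or.inr oa)), hL.pdist_eq hT _ _ (Or.inr (Or.inr ob)), pa, pb,
      oa, ob, pos_vertex, hf]
    simp
  have hne : P.1 ≠ Q.1 := by
    rw [e1, e2]
    intro h
    have h := hL.injective hT h
    rw [pa, pb, Int.floor_neg] at h
    have := Int.ceil_pos.2 hl
    omega
  have hab : |pos L a| = |(l : ℝ)| / 2 ∧ |pos L b| = |(l : ℝ)| / 2 := by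
    rw [pa, pb, abs_neg, abs_of_pos hl]; exact ⟨rfl, rfl⟩
  rcases vertexLT_or hT O hne with h | h
  · refine ⟨(b, a), (hL.isEnds_iff hT hf _).2 ⟨ob, oa, hab.2, hab.1, Or.inr ⟨hd, P, Q, hP, hQ, ?_⟩⟩⟩
    rwa [← vertexLT_iff hT]
  · refine ⟨(a, b), (hL.isEnds_iff hT hf _).2
      ⟨oa, ob, hab.1, hab.2, Or.inr ⟨hd.symm, Q, P, hQ, hP, ?_⟩⟩⟩
    rwa [← vertexLT_iff hT]

theorem IsAxis.isNormalAxis (hT : T.IsTree) (hL : IsAxis g L l) (hf : foot T L v₀ = 0)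
    (hu : 0 < pos L (uPlus O g)) : IsNormalAxis O g L l := by
  have hex := hL.exists_isEnds (O := O) hT hf
  have hends : IsEnds O g (ends O g) := by
    rw [ends, dif_pos hex]; exact hex.choose_spec
  obtain ⟨o1, o2, p1, p2, hlt⟩ := (hL.isEnds_iff hT hf _).1 hends
  change 0 < pos L (ends O g).2 at hu
  rw [abs_of_pos hu] at p2
  have p1' : pos L (ends O g).1 = -(|(l : ℝ)| / 2) := by
    rcases (abs_eq (by positivity)).1 p1 with h | h
    · have := hL.point_ext hT o1 o2 (h.trans p2.symm)
      rw [this] at hlt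
      exact absurd hlt (pointLT_irrefl hT O _)
    · exact h
  refine ⟨hL, hf, ?_, fun m hm => ?_⟩
  · ext p
    rw [UZero, uMinus, uPlus, Set.mem_sdiff, hL.mem_segment hT o1 o2 (by linarith), p1', p2,
      Set.mem_singleton_iff, Set.mem_ofPred_eq]
    constructor
    · rintro ⟨⟨h1, h2, h3⟩, h4⟩
      refine ⟨h1, lt_of_le_of_ne h2 fun h => h4 (hL.point_ext hT h1 o1 (by rw [p1', h])), h3⟩
    · rintro ⟨h1, h2, h3⟩
      exact ⟨⟨h1, h2.le, h3⟩, fun h => by rw [h, p1'] at h2; exact lt_irrefl _ h2⟩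
  · have hm' : |(l : ℝ)| = 2 * m := by exact_mod_cast hm
    rcases hlt with h | ⟨-, P, Q, hP, hQ, h⟩
    · rw [hL.pdist_eq hT _ _ (Or.inr (Or.inr o1)), hL.pdist_eq hT _ _ (Or.inr (Or.inr o2)), p1', p2,
        o1, o2, pos_vertex, hf] at h
      simp at h
    · have e1 := hL.covers_right hT hP o2 hf hu
      have e2 := hL.covers_left hT hQ o1 hf (by rw [p1']; linarith)
      refine ⟨P, Q, ?_, ?_, h⟩
      · rw [e1, p2, hm']
        simp
      · rw [e2, p1', hm', mul_div_cancel_left₀ _ (by norm_num), ← Int.cast_neg, Int.floor_intCast]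

theorem IsHyperbolic.exists_isNormalAxis (hT : T.IsTree) (O : LexPathOrder T v₀)
    (hg : IsHyperbolic g) : ∃ L l, IsNormalAxis O g L l := by
  obtain ⟨L₀, l₀, hL₀⟩ := hg.exists_isAxis hT
  obtain ⟨L, l, hL, hf⟩ : ∃ L l, IsAxis g L l ∧ foot T L v₀ = 0 :=
    ⟨_, _, hL₀.affine 1 (foot T L₀ v₀) (Or.inl rfl), by
      rw [foot_affine hT hL₀.toIsLine 1 _ (Or.inl rfl)]; simp⟩
  have hex := hL.exists_isEnds (O := O) hT hf
  have hends : IsEnds O g (ends O g) := by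
    rw [ends, dif_pos hex]; exact hex.choose_spec
  have p2 := ((hL.isEnds_iff hT hf _).1 hends).2.2.2.1
  have hne : pos L (uPlus O g) ≠ 0 := by
    intro h
    change pos L (ends O g).2 = 0 at h
    have : (l : ℝ) ≠ 0 := by exact_mod_cast hL.ne_zero
    rw [h, abs_zero] at p2
    have : 0 < |(l : ℝ)| := by positivity
    linarith
  rcases hne.lt_or_gt with h | h
  · refine ⟨_, _, (hL.affine (-1) 0 (Or.inr rfl)).isNormalAxis hT ?_ ?_⟩
    · rw [foot_affine hT hL.toIsLine _ _ (Or.inr rfl), hf]; simp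
    · rw [pos_affine hT hL.toIsLine _ _ (Or.inr rfl)]; push_cast; linarith
  · exact ⟨L, l, hL.isNormalAxis hT hf h⟩

/-- The integer `n` lies in the half-open interval of length `|l|` centred at the origin. -/
def InRange (l n : ℤ) : Prop := -|l| < 2 * n ∧ 2 * n ≤ |l|

theorem IsNormalAxis.proj_subset_iff (hT : T.IsTree) (hL : IsNormalAxis O g L l) {h : T ≃g T}
    {M : ℤ → V} {m : ℤ} (hM : IsAxis h M m) :
    proj (minSet g) '' minSet h ⊆ UZero O g ↔ ∀ i, InRange l (foot T L (M i)) := by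
  have hproj : ∀ w, proj (minSet g) w ∈ UZero O g ↔
      -(|(l : ℝ)|) < 2 * pos L w ∧ 2 * pos L w ≤ |(l : ℝ)| := by
    intro w
    rw [hL.proj_eq hT, hL.UZero_eq, Set.mem_ofPred_eq, hL.off_point hT, hL.pos_point hT]
    simp only [true_and]
    constructor <;> rintro ⟨h1, h2⟩ <;> constructor <;> linarith
  have hint : ∀ n : ℤ, InRange l n ↔ -(|(l : ℝ)|) < 2 * (n : ℝ) ∧ 2 * (n : ℝ) ≤ |(l : ℝ)| := by
    intro n; unfold InRange; norm_cast
  rw [Set.image_subset_iff]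
  constructor
  · intro H i
    have := H (show vertex T (M i) ∈ minSet h by
      rw [hM.mem_minSet hT, off_vertex, hM.height_line hT]; simp)
    rw [Set.mem_preimage, hproj, pos_vertex] at this
    exact (hint _).2 this
  · intro H p hp
    rw [hM.mem_minSet hT] at hp
    rw [Set.mem_preimage, hproj]
    have e := hM.eq_point hT hp
    set x := pos M p
    have h1 := (hint _).1 (H ⌊x⌋)
    have h2 := (hint _).1 (H (⌊x⌋ + 1))
    rw [pos, Point.avg_of_eq (show p.1 = _ by rw [e]; rfl)]
    have t0 := Int.fract_nonneg x
    have t1 := Int.fract_lt_one x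
    set t := Int.fract x
    constructor <;> nlinarith

end

end

section

variable {V : Type*} {T : SimpleGraph V} {v₀ : V} {O : LexPathOrder T v₀} {G : Subgroup (T ≃g T)}

/-! ### The fundamental domain of minimal vertices -/

/-- A vertex which is minimal in its orbit. -/
def IsMinimal (O : LexPathOrder T v₀) (G : Subgroup (T ≃g T)) (v : V) : Prop :=
  ∀ g ∈ G, ¬ VertexLT O (g v) v

theorem IsPurelyHyperbolic.eq_one (hG : IsPurelyHyperbolic G) {g : T ≃g T} (hg : g ∈ G) {v : V}
    (h : g v = v) : g = 1 := by
  by_contra h1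
  exact (hG g hg h1).apply_ne v h

theorem isMinimal_base (hT : T.IsTree) : IsMinimal O G v₀ := by
  intro g _ h
  by_cases h0 : g v₀ = v₀
  · rw [h0] at h; exact vertexLT_irrefl hT O _ h
  · have : VertexLT O v₀ (g v₀) := vertexLT_of_dist_lt hT O (by
      rw [SimpleGraph.dist_self]; exact hT.connected.pos_dist_of_ne (Ne.symm h0))
    exact (vertexLT_wellFounded hT O).asymmetric _ _ h this

theorem exists_isMinimal (hT : T.IsTree) (O : LexPathOrder T v₀) (G : Subgroup (T ≃g T)) (v : V) :
    ∃ g ∈ G, IsMinimal O G (g v) := by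
  obtain ⟨w, ⟨g, hg, rfl⟩, hw⟩ := (vertexLT_wellFounded hT O).has_min
    {w | ∃ g ∈ G, g v = w} ⟨v, 1, one_mem _, rfl⟩
  exact ⟨g, hg, fun h hh => hw _ ⟨h * g, mul_mem hh hg, rfl⟩⟩

theorem IsMinimal.eq_one (hT : T.IsTree) (hG : IsPurelyHyperbolic G) {v : V} (hv : IsMinimal O G v)
    {g : T ≃g T} (hg : g ∈ G) (hgv : IsMinimal O G (g v)) : g = 1 := by
  refine hG.eq_one hg (v := v) ?_
  by_contra hne
  rcases vertexLT_or hT O hne with h | h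
  · exact hv g hg h
  · refine hgv g⁻¹ (inv_mem hg) ?_
    rwa [show g⁻¹ (g v) = v from g.symm_apply_apply v]

theorem IsMinimal.eq_of_apply_eq (hT : T.IsTree) (hG : IsPurelyHyperbolic G) {v w : V}
    (hv : IsMinimal O G v) (hw : IsMinimal O G w) {g h : T ≃g T} (hg : g ∈ G) (hh : h ∈ G)
    (e : g v = h w) : g = h := by
  have : h⁻¹ * g = 1 := by
    refine hv.eq_one hT hG (mul_mem (inv_mem hh) hg) ?_
    rw [show (h⁻¹ * g) v = h⁻¹ (g v) from rfl, e, show h⁻¹ (h w) = w from h.symm_apply_apply w]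
    exact hw
  rw [← mul_one h, ← this, mul_inv_cancel_left]

theorem IsMinimal.parent (hT : T.IsTree) {u v : V} (hv : IsMinimal O G v) (huv : T.Adj u v)
    (hd : T.dist v₀ v = T.dist v₀ u + 1) : IsMinimal O G u := by
  intro g hg h
  have hle : T.dist v₀ (g u) ≤ T.dist v₀ u := by
    by_contra hc
    exact (vertexLT_wellFounded hT O).asymmetric _ _ h (vertexLT_of_dist_lt hT O (not_le.1 hc))
  have hadj : T.Adj (g u) (g v) := (adj_apply g).2 huv
  have h1 := dist_eq_one_iff_adj.2 hadj
  have h2 := hT.connected.dist_triangle (u := v₀) (v := g u) (w := g v)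
  refine hv g hg ?_
  by_cases hlt : T.dist v₀ (g v) < T.dist v₀ v
  · exact vertexLT_of_dist_lt hT O hlt
  · refine vertexLT_of_between hT O (by omega) (by omega) (by omega) ?_ h
    rw [dist_eq_one_iff_adj.2 huv, hd]

theorem isMinimal_induction (hT : T.IsTree) {P : V → Prop} (h0 : P v₀)
    (hs : ∀ u v, IsMinimal O G u → IsMinimal O G v → T.Adj u v → P u → P v) {v : V}
    (hv : IsMinimal O G v) : P v := by
  induction hn : T.dist v₀ v generalizing v with
  | zero => rwa [← hT.connected.dist_eq_zero_iff.1 hn]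
  | succ n ih =>
    have hne : v ≠ v₀ := by rintro rfl; simp at hn
    obtain ⟨u, hu, hd⟩ := exists_adj_dist_eq hT hne
    have hmu := hv.parent hT hu.symm hd
    exact hs u v hmu hv hu.symm (ih hmu (by omega))

section Axis

variable {g : T ≃g T} {L : ℤ → V} {l : ℤ}

theorem IsAxis.exists_pos_translation (hL : IsAxis g L l) :
    ∃ e : T ≃g T, (e = g ∨ e = g⁻¹) ∧ IsAxis e L |l| := by
  rcases abs_choice l with h | h
  · exact ⟨g, Or.inl rfl, by rwa [h]⟩
  · exact ⟨g⁻¹, Or.inr rfl, by rw [h]; exact hL.inv⟩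

theorem mem_of_eq_or_inv {e : T ≃g T} (hg : g ∈ G) (he : e = g ∨ e = g⁻¹) : e ∈ G := by
  rcases he with rfl | rfl
  · exact hg
  · exact inv_mem hg

theorem IsMinimal.inRange_foot (hT : T.IsTree) {v : V} (hv : IsMinimal O G v) (hg : g ∈ G)
    (hL : IsNormalAxis O g L l) : InRange l (foot T L v) := by
  obtain ⟨e, he, hE⟩ := hL.exists_pos_translation
  have heG := mem_of_eq_or_inv hg he
  have hpos : 0 < |l| := abs_pos.2 hL.ne_zero
  have hf := hL.foot_base
  have hlt : ∀ x ∈ G, |foot T L (x v)| < |foot T L v| → height T L (x v) = height T L v → False := by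
    intro x hx h1 h2
    refine hv x hx (vertexLT_of_dist_lt hT O ?_)
    have d1 := hL.dist_le hT v₀ (x v)
    have d2 := hL.dist_eq_of_ne hT (v := v₀) (w := v) (by
      rw [hf]; intro h; rw [← h] at h1; simp at h1; linarith [abs_nonneg (foot T L (x v))])
    rw [hf, zero_sub, abs_neg] at d1 d2
    omega
  by_contra hc
  unfold InRange at hc
  by_cases h1 : 2 * foot T L v ≤ |l|
  · have f1 := hE.foot_map hT v
    have f2 := hE.height_map hT v
    by_cases h2 : 2 * foot T L v = -|l|
    · have hm : |l| = 2 * (-foot T L v) := by omega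
      have hlt := hL.lt _ hm
      rw [neg_neg] at hlt
      have f3 : foot T L (e v) = -foot T L v := by omega
      have d1 := hL.dist_eq_of_ne hT (v := v₀) (w := v) (by omega)
      have d2 := hL.dist_eq_of_ne hT (v := v₀) (w := e v) (by omega)
      have d3 := hL.dist_eq hT v₀ (foot T L v)
      have d4 := hL.dist_eq hT v₀ (-foot T L v)
      have d5 : (T.dist (L (foot T L v)) v : ℤ) = height T L v := by
        rw [SimpleGraph.dist_comm]; rfl
      have d6 : (T.dist (L (-foot T L v)) (e v) : ℤ) = height T L v := by
        rw [SimpleGraph.dist_comm, ← f3, ← f2]; rfl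
      rw [hf, zero_sub, abs_neg] at d1 d2
      rw [hf, sub_zero] at d3 d4
      rw [f3, abs_neg, f2] at d2
      rw [abs_neg] at d4
      exact hv e heG (vertexLT_of_between hT O (by omega) (by omega) (by omega) (by omega) hlt)
    · refine hlt e heG ?_ f2
      rw [f1, abs_of_nonpos (a := foot T L v) (by omega), abs_lt]
      omega
  · have f1 := hE.inv.foot_map hT v
    have f2 := hE.inv.height_map hT v
    refine hlt e⁻¹ (inv_mem heG) ?_ f2
    rw [f1, abs_of_nonneg (a := foot T L v) (by omega), abs_lt]
    omega

theorem IsNormalAxis.isMinimal_line (hT : T.IsTree) (hL : IsNormalAxis O g L l) {i j : ℤ}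
    (hi : IsMinimal O G (L i)) (hj : (0 ≤ j ∧ j ≤ i) ∨ (i ≤ j ∧ j ≤ 0)) : IsMinimal O G (L j) := by
  have hd : ∀ k, (T.dist v₀ (L k) : ℤ) = height T L v₀ + |k| := fun k => by
    rw [hL.dist_eq hT, hL.foot_base, sub_zero]
  rcases hj with ⟨h0, h1⟩ | ⟨h1, h0⟩
  · induction j, h1 using Int.leInductionDown with
    | base => exact hi
    | pred n hn ih =>
      have a := hL.adj (n - 1)
      rw [sub_add_cancel] at a
      refine (ih (by omega)).parent hT a ?_
      have := hd n
      have := hd (n - 1)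
      rw [abs_of_nonneg (by omega)] at *
      omega
  · induction j, h1 using Int.leInduction with
    | base => exact hi
    | succ n hn ih =>
      refine (ih (by omega)).parent hT (hL.adj n).symm ?_
      have := hd n
      have := hd (n + 1)
      rw [abs_of_nonpos (by omega)] at *
      omega

/-- An edge leaving the preimage of the fundamental interval runs along the axis. -/
theorem IsAxis.exists_of_leave (hT : T.IsTree) (hL : IsAxis g L l) {x y : V} (hxy : T.Adj x y)
    (hx : InRange l (foot T L x)) (hy : ¬ InRange l (foot T L y)) :
    ∃ e : T ≃g T, (e = g ∨ e = g⁻¹) ∧ x = L (foot T L x) ∧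
      ∃ n, InRange l n ∧ y = e (L n) := by
  rcases hL.adj_cases hT hxy with ⟨h1, h2, h3⟩ | ⟨h1, -⟩
  · have ex := eq_line_foot_of_height_eq_zero hT h1
    have ey := eq_line_foot_of_height_eq_zero hT h2
    have hpos : 0 < |l| := abs_pos.2 hL.ne_zero
    obtain ⟨e, he, hE⟩ := hL.exists_pos_translation
    unfold InRange at *
    rcases h3 with h3 | h3
    · refine ⟨e, he, ex, foot T L y - |l|, by omega, ?_⟩
      rw [hE.map, sub_add_cancel]; exact ey
    · refine ⟨e⁻¹, ?_, ex, foot T L y + |l|, by omega, ?_⟩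
      · rcases he with rfl | rfl <;> simp
      · rw [hE.inv.map, add_neg_cancel_right]; exact ey
  · rw [h1] at hx; exact absurd hx hy

/-- If the fundamental interval of `g` lies in the fundamental domain, then only edges from the
domain to its translates by `g` and `g⁻¹` leave the preimage of the interval. -/
theorem IsNormalAxis.eq_of_leave (hT : T.IsTree) (hG : IsPurelyHyperbolic G)
    (hL : IsNormalAxis O g L l) (hg : g ∈ G)
    (hmin : ∀ j, InRange l j → IsMinimal O G (L j)) {s t : T ≃g T} (hs : s ∈ G) (ht : t ∈ G)
    {u v : V} (hu : IsMinimal O G u) (hv : IsMinimal O G v) (hadj : T.Adj (s u) (t v))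
    (h1 : InRange l (foot T L (s u))) (h2 : ¬ InRange l (foot T L (t v))) :
    s = 1 ∧ (t = g ∨ t = g⁻¹) := by
  obtain ⟨e, he, hx, n, hn, hy⟩ := hL.exists_of_leave hT hadj h1 h2
  have heG := mem_of_eq_or_inv hg he
  refine ⟨hu.eq_one hT hG hs (by rw [hx]; exact hmin _ h1), ?_⟩
  rw [hv.eq_of_apply_eq hT hG (hmin n hn) ht heG hy]
  exact he

end Axis

/-! ### The side pairing elements of the fundamental domain -/

/-- The elements which move the fundamental domain to an adjacent translate. -/
def sidePairings (O : LexPathOrder T v₀) (G : Subgroup (T ≃g T)) : Set (T ≃g T) :=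
  {x | x ∈ G ∧ x ≠ 1 ∧ ∃ a b, IsMinimal O G a ∧ IsMinimal O G b ∧ T.Adj a (x b)}

theorem inv_mem_sidePairings {x : T ≃g T} (hx : x ∈ sidePairings O G) :
    x⁻¹ ∈ sidePairings O G := by
  obtain ⟨h1, h2, a, b, ha, hb, hab⟩ := hx
  refine ⟨inv_mem h1, inv_ne_one.2 h2, b, a, hb, ha, ?_⟩
  rw [← adj_apply x, show x (x⁻¹ a) = a from x.apply_symm_apply a]
  exact hab.symm

theorem closure_sidePairings (hT : T.IsTree) (O : LexPathOrder T v₀) (hG : IsPurelyHyperbolic G) :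
    Subgroup.closure (sidePairings O G) = G := by
  refine le_antisymm ((Subgroup.closure_le _).2 fun x hx => hx.1) fun g hg => ?_
  choose r hr hmin using exists_isMinimal hT O G
  have step : ∀ x y, T.Adj x y → r x * (r y)⁻¹ ∈ Subgroup.closure (sidePairings O G) := by
    intro x y h
    by_cases h1 : r x * (r y)⁻¹ = 1
    · rw [h1]; exact one_mem _
    · refine Subgroup.subset_closure ⟨mul_mem (hr x) (inv_mem (hr y)), h1, _, _, hmin x, hmin y, ?_⟩
      rw [show (r x * (r y)⁻¹) (r y y) = r x ((r y)⁻¹ (r y y)) from rfl,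
        show (r y)⁻¹ (r y y) = y from (r y).symm_apply_apply y]
      exact (adj_apply _).2 h
  have key : ∀ {x y : V}, T.Walk x y → r x * (r y)⁻¹ ∈ Subgroup.closure (sidePairings O G) := by
    intro x y p
    induction p with
    | nil => rw [mul_inv_cancel]; exact one_mem _
    | cons h q ih =>
      have := mul_mem (step _ _ h) ih
      rwa [mul_assoc, inv_mul_cancel_left] at this
  obtain ⟨p⟩ := hT.connected.preconnected v₀ (g v₀)
  have h0 : r v₀ = 1 := (isMinimal_base hT).eq_one hT hG (hr _) (hmin _)
  have h1 : r (g v₀) * g = 1 :=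
    (isMinimal_base hT).eq_one hT hG (mul_mem (hr _) hg) (hmin (g v₀))
  have := key p
  rwa [h0, one_mul, ← eq_inv_of_mul_eq_one_right h1] at this

theorem IsNormalAxis.isMinimal_of_inRange (hT : T.IsTree)
    {x : T ≃g T} {L : ℤ → V} {l : ℤ} (hL : IsNormalAxis O x L l) (hx : x ∈ sidePairings O G) {j : ℤ}
    (hj : InRange l j) : IsMinimal O G (L j) := by
  obtain ⟨hxG, hx1, a, b, ha, hb, hab⟩ := hx
  have ra := ha.inRange_foot hT hxG hL
  have rb := hb.inRange_foot hT hxG hL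
  have fb := hL.foot_map hT b
  have hb' := hL.height_map hT b
  have hl := hL.ne_zero
  rcases hL.adj_cases hT hab with ⟨h1, h2, h3⟩ | ⟨h1, -⟩
  · have ea := eq_line_foot_of_height_eq_zero hT h1
    have eb := eq_line_foot_of_height_eq_zero hT (hb'.symm.trans h2)
    rw [ea] at ha
    rw [eb] at hb
    have hcase : ((0 ≤ j ∧ j ≤ foot T L a) ∨ (foot T L a ≤ j ∧ j ≤ 0)) ∨
        ((0 ≤ j ∧ j ≤ foot T L b) ∨ (foot T L b ≤ j ∧ j ≤ 0)) := by
      unfold InRange at *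
      rcases abs_cases l with h | h <;> omega
    rcases hcase with h | h
    · exact hL.isMinimal_line hT ha h
    · exact hL.isMinimal_line hT hb h
  · unfold InRange at *
    rcases abs_cases l with h | h <;> omega

theorem exists_inRange {l : ℤ} (hl : l ≠ 0) (i : ℤ) : ∃ q r, InRange l r ∧ i = r + q * l := by
  have hpos : 0 < |l| := abs_pos.2 hl
  obtain ⟨q, r, h, e⟩ : ∃ q r, InRange l r ∧ i = r + q * |l| := by
    have h1 := Int.emod_nonneg i hpos.ne'
    have h2 := Int.emod_lt_of_pos i hpos
    have h3 := Int.emod_add_mul_ediv i |l|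
    unfold InRange
    by_cases h : 2 * (i % |l|) ≤ |l|
    · exact ⟨i / |l|, i % |l|, by omega, by linarith [mul_comm |l| (i / |l|)]⟩
    · exact ⟨i / |l| + 1, i % |l| - |l|, by omega, by linarith [mul_comm |l| (i / |l|)]⟩
  rcases abs_choice l with h' | h'
  · exact ⟨q, r, h, by rw [e, h']⟩
  · exact ⟨-q, r, h, by rw [e, h']; ring⟩

theorem IsAxis.zpow_apply {g : T ≃g T} {L : ℤ → V} {l : ℤ} (hL : IsAxis g L l) (n i : ℤ) :
    (g ^ n) (L i) = L (i + n * l) := by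
  induction n using Int.induction_on generalizing i with
  | zero => simp
  | succ n ih =>
    rw [zpow_add_one]
    change (g ^ (n : ℤ)) (g (L i)) = _
    rw [hL.map, ih]; congr 1; ring
  | pred n ih =>
    rw [zpow_sub_one]
    change (g ^ (-n : ℤ)) (g⁻¹ (L i)) = _
    rw [hL.inv.map, ih]; congr 1; ring

/-- The axis of a side pairing projects into the fundamental interval of every other one. -/
theorem IsNormalAxis.inRange_of_sidePairings (hT : T.IsTree) (hG : IsPurelyHyperbolic G)
    {g h : T ≃g T} {L M : ℤ → V} {l m : ℤ} (hL : IsNormalAxis O g L l) (hM : IsNormalAxis O h M m)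
    (hg : g ∈ sidePairings O G) (hh : h ∈ sidePairings O G) (h1 : h ≠ g) (h2 : h ≠ g⁻¹) (i : ℤ) :
    InRange l (foot T L (M i)) := by
  have hmin : ∀ j, InRange l j → IsMinimal O G (L j) := fun j hj =>
    hL.isMinimal_of_inRange hT hg hj
  have hleave : ∀ {s t : T ≃g T} (hs : s ∈ G) (ht : t ∈ G) {u v : V} (hu : IsMinimal O G u)
      (hv : IsMinimal O G v) (hadj : T.Adj (s u) (t v)), InRange l (foot T L (s u)) →
      ¬ InRange l (foot T L (t v)) → s = 1 ∧ (t = g ∨ t = g⁻¹) := fun hs ht _ _ hu hv hadj r1 r2 =>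
    hL.eq_of_leave hT hG hg.1 hmin hs ht hu hv hadj r1 r2
  have hg1 := hg.2.1
  have tile : ∀ t ∈ G, ∀ v, IsMinimal O G v →
      (InRange l (foot T L (t v)) ↔ InRange l (foot T L (t v₀))) := by
    intro t ht v hv
    refine isMinimal_induction hT
      (P := fun v => (InRange l (foot T L (t v)) ↔ InRange l (foot T L (t v₀)))) Iff.rfl ?_ hv
    intro u w hu hw huw ih
    rw [← ih]
    have ne : ¬ (t = 1 ∧ (t = g ∨ t = g⁻¹)) := by
      rintro ⟨e, e' | e'⟩
      · exact hg1 (e'.symm.trans e)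
      · exact hg1 (inv_eq_one.1 (e'.symm.trans e))
    constructor <;> intro H <;> by_contra hc
    · exact ne (hleave ht ht hw hu ((adj_apply t).2 huw.symm) H hc)
    · exact ne (hleave ht ht hu hw ((adj_apply t).2 huw) H hc)
  obtain ⟨hhG, hh1, a, b, ha, hb, hab⟩ := hh
  have adj : ∀ n : ℤ, T.Adj ((h ^ n) a) ((h ^ (n + 1)) b) := fun n => by
    rw [zpow_add_one]
    exact (adj_apply (h ^ n)).2 hab
  have step : ∀ n : ℤ, InRange l (foot T L ((h ^ n) v₀)) ↔
      InRange l (foot T L ((h ^ (n + 1)) v₀)) := by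
    intro n
    have m1 := zpow_mem hhG n
    have m2 := zpow_mem hhG (n + 1)
    rw [← tile _ m1 a ha, ← tile _ m2 b hb]
    constructor <;> intro H <;> by_contra hc
    · obtain ⟨e1, e2⟩ := hleave m1 m2 ha hb (adj n) H hc
      rw [zpow_add_one, e1, one_mul] at e2
      exact e2.elim h1 h2
    · obtain ⟨e1, e2⟩ := hleave m2 m1 hb ha (adj n).symm H hc
      rw [zpow_add_one] at e1
      rw [eq_inv_of_mul_eq_one_left e1, inv_eq_iff_eq_inv, inv_inj] at e2
      exact e2.elim h2 h1
  have all : ∀ n : ℤ, InRange l (foot T L ((h ^ n) v₀)) := by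
    intro n
    induction n using Int.induction_on with
    | zero => exact (isMinimal_base hT).inRange_foot hT hg.1 hL
    | succ n ih => exact (step n).1 ih
    | pred n ih => exact (step _).2 (by rwa [sub_add_cancel])
  obtain ⟨q, r, hr, rfl⟩ := exists_inRange hM.ne_zero i
  rw [← hM.zpow_apply, tile _ (zpow_mem hhG q) _
    (hM.isMinimal_of_inRange hT ⟨hhG, hh1, a, b, ha, hb, hab⟩ hr)]
  exact all q

end

section

variable {V : Type*} {T : SimpleGraph V} {v₀ : V} {O : LexPathOrder T v₀} {G : Subgroup (T ≃g T)}

/-! ### Reduced words -/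

/-- `ReducedWord X g s w` says that `w` is a non-empty reduced product of elements of `X` and their
inverses whose first letter is `g ^ s`. -/
inductive ReducedWord {Γ : Type*} [Group Γ] (X : Set Γ) : Γ → ℤ → Γ → Prop
  | single (g : Γ) (s : ℤ) (hg : g ∈ X) (hs : s = 1 ∨ s = -1) : ReducedWord X g s (g ^ s)
  | cons (g : Γ) (s : ℤ) (h : Γ) (t : ℤ) (w : Γ) (hg : g ∈ X) (hs : s = 1 ∨ s = -1)
      (hw : ReducedWord X h t w) (hne : h ≠ g ∨ t = s) : ReducedWord X g s (g ^ s * w)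

theorem ReducedWord.sign {Γ : Type*} [Group Γ] {X : Set Γ} {g w : Γ} {s : ℤ}
    (h : ReducedWord X g s w) : s = 1 ∨ s = -1 := by
  cases h <;> assumption

theorem exists_reducedWord {Γ : Type*} [Group Γ] {X : Set Γ} {w : Γ}
    (hw : w ∈ Subgroup.closure X) : w = 1 ∨ ∃ g s, ReducedWord X g s w := by
  have key : ∀ g ∈ X, ∀ s : ℤ, (s = 1 ∨ s = -1) → ∀ w, (w = 1 ∨ ∃ g s, ReducedWord X g s w) →
      (g ^ s * w = 1 ∨ ∃ g' s', ReducedWord X g' s' (g ^ s * w)) := by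
    rintro g hg s hs w (rfl | ⟨h, t, hw⟩)
    · rw [mul_one]; exact Or.inr ⟨g, s, .single g s hg hs⟩
    · by_cases hne : h ≠ g ∨ t = s
      · exact Or.inr ⟨g, s, .cons g s h t w hg hs hw hne⟩
      · rw [not_or, not_not] at hne
        obtain ⟨rfl, hts⟩ := hne
        have ht : t = -s := by have := hw.sign; omega
        subst ht
        cases hw with
        | single => left; simp
        | cons _ _ h' t' w' _ _ hw' _ =>
          right; refine ⟨h', t', ?_⟩
          simpa using hw'
  induction hw using Subgroup.closure_induction_left with
  | one => exact Or.inl rfl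
  | mul_left x hx y _ ih => simpa using key x hx 1 (Or.inl rfl) y ih
  | inv_mul_cancel x hx y _ ih => simpa using key x hx (-1) (Or.inr rfl) y ih

/-! ### Ping-pong -/

/-- The integer `n` lies beyond the interval of length `|m|` centred at the origin, on the side to
which the translation by `m` moves it. -/
def Beyond (m n : ℤ) : Prop := ¬ InRange m n ∧ (0 < m → 0 < n) ∧ (m < 0 → n < 0)

theorem Beyond.add {m n : ℤ} (h : InRange m n ∨ Beyond m n) : Beyond m (n + m) := by
  unfold Beyond InRange at *
  rcases abs_cases m with h' | h' <;> omega

theorem inRange_mul {s l n : ℤ} (hs : s = 1 ∨ s = -1) : InRange (s * l) n ↔ InRange l n := by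
  unfold InRange
  rcases hs with rfl | rfl <;> simp

theorem IsAxis.zpow_sign {g : T ≃g T} {L : ℤ → V} {l : ℤ} (hL : IsAxis g L l) {s : ℤ}
    (hs : s = 1 ∨ s = -1) : IsAxis (g ^ s) L (s * l) := by
  rcases hs with rfl | rfl
  · simpa using hL
  · simpa using hL.inv

theorem IsLine.inRange_or (hT : T.IsTree) {L M : ℤ → V} {l m : ℤ} (hL : IsLine T L)
    (hM : IsLine T M) (hLM : ∀ i, InRange l (foot T L (M i)))
    (hML : ∀ i, InRange m (foot T M (L i))) (v : V) :
    InRange l (foot T L v) ∨ InRange m (foot T M v) := by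
  by_contra hc
  rw [not_or] at hc
  have hne : foot T L v ≠ foot T L (M (foot T M v)) := fun h => hc.1 (h ▸ hLM _)
  have d1 := hL.dist_eq_of_ne hT hne
  have d2 : (T.dist v (L (foot T L v)) : ℤ) = height T L v := rfl
  have d3 : (T.dist v (M (foot T M v)) : ℤ) = height T M v := rfl
  have hne' : foot T M v ≠ foot T M (L (foot T L v)) := fun h => hc.2 (h ▸ hML _)
  have d4 := hM.dist_eq_of_ne hT hne'
  have p1 : 0 < |foot T L v - foot T L (M (foot T M v))| := abs_pos.2 (sub_ne_zero.2 hne)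
  have p2 := abs_nonneg (foot T M v - foot T M (L (foot T L v)))
  have p3 := height_nonneg (T := T) (L := L) (M (foot T M v))
  have p4 := height_nonneg (T := T) (L := M) (L (foot T L v))
  omega

variable {A : (T ≃g T) → ℤ → V} {l : (T ≃g T) → ℤ} {X : Set (T ≃g T)}

theorem ReducedWord.beyond (hT : T.IsTree) (hA : ∀ g ∈ X, IsAxis g (A g) (l g))
    (hX : ∀ g ∈ X, ∀ h ∈ X, h ≠ g → ∀ i, InRange (l g) (foot T (A g) (A h i)))
    {g w : T ≃g T} {s : ℤ} (hw : ReducedWord X g s w) {v : V}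
    (hv : ∀ g ∈ X, InRange (l g) (foot T (A g) v)) :
    g ∈ X ∧ Beyond (s * l g) (foot T (A g) (w v)) := by
  induction hw with
  | single g s hg hs =>
    have h := (hA g hg).zpow_sign hs
    refine ⟨hg, ?_⟩
    rw [h.foot_map hT]
    exact Beyond.add (Or.inl ((inRange_mul hs).2 (hv g hg)))
  | cons g s h t w hg hs hw hne ih =>
    obtain ⟨hh, hb⟩ := ih
    have ha := (hA g hg).zpow_sign hs
    refine ⟨hg, ?_⟩
    rw [show (g ^ s * w) v = (g ^ s) (w v) from rfl, ha.foot_map hT]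
    refine Beyond.add ?_
    by_cases hgh : h = g
    · subst hgh
      rcases hne with hne | rfl
      · exact absurd rfl hne
      · exact Or.inr hb
    · left
      rw [inRange_mul hs]
      refine ((hA g hg).inRange_or hT (hA h hh).toIsLine (hX g hg h hh hgh)
        (hX h hh g hg (Ne.symm hgh)) (w v)).resolve_right fun hc => ?_
      exact hb.1 ((inRange_mul hw.sign).2 hc)

/-! ### Fundamental systems -/

theorem sidePairings_eq_of_reduced (hT : T.IsTree) (hG : IsPurelyHyperbolic G)
    (hA : ∀ g ∈ X, IsNormalAxis O g (A g) (l g)) (hcl : Subgroup.closure X = G)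
    (hX : ∀ g ∈ X, ∀ h ∈ X, h ≠ g → ∀ i, InRange (l g) (foot T (A g) (A h i))) :
    sidePairings O G = X ∪ {x | x⁻¹ ∈ X} := by
  have hXG : ∀ g ∈ X, g ∈ G := fun g hg => hcl ▸ Subgroup.subset_closure hg
  have hdom : ∀ v, IsMinimal O G v ↔ ∀ g ∈ X, InRange (l g) (foot T (A g) v) := by
    intro v
    refine ⟨fun hv g hg => hv.inRange_foot hT (hXG g hg) (hA g hg), fun hv => ?_⟩
    obtain ⟨w, hw, hmin⟩ := exists_isMinimal hT O G v
    rcases exists_reducedWord (hcl.symm ▸ hw : w ∈ Subgroup.closure X) with rfl | ⟨g, s, hr⟩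
    · exact hmin
    · obtain ⟨hg, hb⟩ := hr.beyond hT (fun g hg => (hA g hg).toIsAxis) hX hv
      exact absurd ((inRange_mul hr.sign).2 (hmin.inRange_foot hT (hXG g hg) (hA g hg))) hb.1
  have hline : ∀ g ∈ X, ∀ j, InRange (l g) j → IsMinimal O G (A g j) := by
    intro g hg j hj
    refine (hdom _).2 fun h hh => ?_
    by_cases e : g = h
    · subst e; rwa [(hA g hg).foot_line hT]
    · exact hX h hh g hg e j
  ext x
  constructor
  · rintro ⟨hxG, hx1, a, b, ha, hb, hab⟩
    have hxb : ¬ IsMinimal O G (x b) := fun h => hx1 (hb.eq_one hT hG hxG h)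
    rw [hdom] at hxb
    push Not at hxb
    obtain ⟨g, hg, hgx⟩ := hxb
    have := ((hA g hg).eq_of_leave hT hG (hXG g hg) (hline g hg) (one_mem G) hxG ha hb hab
      (ha.inRange_foot hT (hXG g hg) (hA g hg)) hgx).2
    rcases this with rfl | rfl
    · exact Or.inl hg
    · exact Or.inr (by simpa using hg)
  · have key : ∀ g ∈ X, g ∈ sidePairings O G := by
      intro g hg
      obtain ⟨e, he, hE⟩ := (hA g hg).exists_pos_translation
      have heG := mem_of_eq_or_inv (hXG g hg) he
      have hpos : 0 < |l g| := abs_pos.2 (hA g hg).ne_zero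
      have h1 : InRange (l g) (|l g| / 2) := by unfold InRange; omega
      have h2 : InRange (l g) (|l g| / 2 + 1 - |l g|) := by unfold InRange; omega
      have h3 : e ∈ sidePairings O G := by
        refine ⟨heG, ?_, _, _, hline g hg _ h1, hline g hg _ h2, ?_⟩
        · rintro rfl
          have := hE.injective hT (hE.map 0)
          omega
        · rw [hE.map, sub_add_cancel]
          exact hE.adj _
      rcases he with rfl | rfl
      · exact h3
      · simpa using inv_mem_sidePairings h3
    rintro (hx | hx)
    · exact key x hx
    · simpa using inv_mem_sidePairings (key _ hx)

/-- The three sets contributed by one element to a fundamental system. -/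
def pieces (O : LexPathOrder T v₀) (g : T ≃g T) : Set (Set (Point T)) :=
  {UMinus O g, UZero O g, UPlus O g}

theorem IsHyperbolic.pieces_inv (hT : T.IsTree) {g : T ≃g T} (hg : IsHyperbolic g) :
    pieces O g⁻¹ = pieces O g := by
  obtain ⟨L, l, hL⟩ := hg.exists_isAxis hT
  have h1 := hL.minSet_inv hT
  have h2 := hL.translationLength_inv hT
  have h3 : center v₀ g⁻¹ = center v₀ g := by rw [center, center, h1]
  have h4 : ends O g⁻¹ = ends O g := by
    have : IsEnds O g⁻¹ = IsEnds O g := by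
      funext u; rw [IsEnds, IsEnds, h1, h2, h3]
    rw [ends, ends, this]
  simp only [pieces, UMinus, UPlus, UZero, uMinus, uPlus, h1, h4]

theorem IsFundamentalSystemOfSet.eq_biUnion_sidePairings (hT : T.IsTree) (hG : IsPurelyHyperbolic G)
    {U : Set (Set (Point T))} (hcl : Subgroup.closure X = G)
    (hU : IsFundamentalSystemOfSet O X U) : U = ⋃ g ∈ sidePairings O G, pieces O g := by
  obtain ⟨h1, h2, rfl⟩ := hU
  have hhyp : ∀ g ∈ X, IsHyperbolic g := fun g hg => isHyperbolic_of_not_isElliptic (h1 g hg)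
  have hax : ∀ g, ∃ L : ℤ → V, ∃ l : ℤ, g ∈ X → IsNormalAxis O g L l := by
    intro g
    by_cases hg : g ∈ X
    · obtain ⟨L, l, h⟩ := (hhyp g hg).exists_isNormalAxis hT O
      exact ⟨L, l, fun _ => h⟩
    · exact ⟨fun _ => v₀, 0, fun h => absurd h hg⟩
  choose A l hA using hax
  rw [sidePairings_eq_of_reduced (O := O) hT hG hA hcl fun g hg h hh hne =>
    ((hA g hg).proj_subset_iff hT (hA h hh).toIsAxis).1 (h2 g hg h ⟨hh, hne⟩)]
  refine le_antisymm ?_ ?_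
  · exact Set.biUnion_subset_biUnion_left (Set.subset_union_left)
  · refine Set.iUnion₂_subset fun g hg => ?_
    rcases hg with hg | hg
    · exact Set.subset_biUnion_of_mem (u := fun g => pieces O g) hg
    · have := (hhyp _ hg).pieces_inv (O := O) hT
      rw [inv_inv] at this
      rw [this]
      exact Set.subset_biUnion_of_mem (u := fun g => pieces O g) hg

/-- A finitely generated group generated by a set `S` is generated by a finite part of `S` which
does not contain two different mutually inverse elements. -/
theorem exists_finite_generating_subset {Γ : Type*} [Group Γ] {H : Subgroup Γ} (hH : H.FG)
    {S : Set Γ} (hS : Subgroup.closure S = H) : ∃ X ⊆ S, X.Finite ∧ Subgroup.closure X = H ∧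
      ∀ g ∈ X, ∀ h ∈ X, h ≠ g → h ≠ g⁻¹ := by
  classical
  have hex : ∃ n, ∃ X : Finset Γ, (X : Set Γ) ⊆ S ∧ Subgroup.closure (X : Set Γ) = H ∧
      X.card = n := by
    obtain ⟨F, hF⟩ := hH
    have hfin : ∀ x ∈ Subgroup.closure S, ∃ Y : Finset Γ, (Y : Set Γ) ⊆ S ∧
        x ∈ Subgroup.closure (Y : Set Γ) := by
      intro x hx
      induction hx using Subgroup.closure_induction with
      | mem x hx => exact ⟨{x}, by simpa using hx, Subgroup.subset_closure (by simp)⟩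
      | one => exact ⟨∅, by simp, one_mem _⟩
      | mul x y _ _ ihx ihy =>
        obtain ⟨Y, hY, hx⟩ := ihx
        obtain ⟨Z, hZ, hy⟩ := ihy
        refine ⟨Y ∪ Z, by simp [hY, hZ], mul_mem ?_ ?_⟩
        · exact Subgroup.closure_mono (by simp) hx
        · exact Subgroup.closure_mono (by simp) hy
      | inv x _ ihx =>
        obtain ⟨Y, hY, hx⟩ := ihx
        exact ⟨Y, hY, inv_mem hx⟩
    have hFS : ∀ x ∈ F, x ∈ Subgroup.closure S := fun x hx => by
      rw [hS, ← hF]; exact Subgroup.subset_closure hx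
    choose! Y hY hxY using fun x (hx : x ∈ F) => hfin x (hFS x hx)
    have hsub : ((F.biUnion Y : Finset Γ) : Set Γ) ⊆ S := by
      intro y hy
      obtain ⟨x, hx, hxy⟩ := Finset.mem_biUnion.1 (Finset.mem_coe.1 hy)
      exact hY x hx hxy
    refine ⟨_, F.biUnion Y, hsub, le_antisymm ?_ ?_, rfl⟩
    · rw [← hS]; exact Subgroup.closure_mono hsub
    · rw [← hF, Subgroup.closure_le]
      exact fun x hx => Subgroup.closure_mono
        (Finset.coe_subset.2 (Finset.subset_biUnion_of_mem Y hx)) (hxY x hx)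
  obtain ⟨X, hXS, hX, hcard⟩ := Nat.find_spec hex
  refine ⟨X, hXS, X.finite_toSet, hX, fun g hg h hh hne hinv => ?_⟩
  refine Nat.find_min hex (m := (X.erase h).card) ?_ ⟨X.erase h, ?_, ?_, rfl⟩
  · rw [← hcard]; exact Finset.card_erase_lt_of_mem hh
  · exact fun x hx => hXS (Finset.mem_of_mem_erase hx)
  · refine le_antisymm ?_ ?_
    · rw [← hX]; exact Subgroup.closure_mono (by simp)
    · rw [← hX, Subgroup.closure_le]
      intro x hx
      by_cases e : x = h
      · rw [e.trans hinv]
        exact inv_mem (Subgroup.subset_closure (by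
          rw [Finset.mem_coe]; exact Finset.mem_erase.2 ⟨Ne.symm hne, hg⟩))
      · exact Subgroup.subset_closure (by
          rw [Finset.mem_coe]; exact Finset.mem_erase.2 ⟨e, hx⟩)

end

end TreeAut

theorem mainTheorem10 {V : Type*} (T : SimpleGraph V) (hT : T.IsTree) (v₀ : V)
    (O : TreeAut.LexPathOrder T v₀) (G : Subgroup (T ≃g T)) (hfg : G.FG)
    (hG : TreeAut.IsPurelyHyperbolic G) :
    ∃! U : Set (Set (TreeAut.Point T)), TreeAut.IsFundamentalSystem O G U := by
  obtain ⟨X, hXS, hfin, hcl, hinv⟩ := TreeAut.exists_finite_generating_subset hfg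
    (TreeAut.closure_sidePairings hT O hG)
  have hhyp : ∀ g ∈ X, TreeAut.IsHyperbolic g := fun g hg => hG g (hXS hg).1 (hXS hg).2.1
  have hX : TreeAut.IsFundamentalSystemOfSet O X
      (⋃ g ∈ X, {TreeAut.UMinus O g, TreeAut.UZero O g, TreeAut.UPlus O g}) := by
    refine ⟨fun g hg => (hhyp g hg).not_isElliptic, fun g hg h hh => ?_, rfl⟩
    obtain ⟨L, l, hL⟩ := (hhyp g hg).exists_isNormalAxis hT O
    obtain ⟨M, m, hM⟩ := (hhyp h hh.1).exists_isNormalAxis hT O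
    exact (hL.proj_subset_iff hT hM.toIsAxis).2 (hL.inRange_of_sidePairings hT hG hM (hXS hg)
      (hXS hh.1) hh.2 (hinv g hg h hh.1 hh.2))
  refine ⟨_, ⟨X, hfin, hcl, hX⟩, ?_⟩
  rintro U ⟨Y, -, hY, hU⟩
  rw [hU.eq_biUnion_sidePairings hT hG hY, hX.eq_biUnion_sidePairings hT hG hcl]
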